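/- **Conventions.** Let $X$ be a compact connected complex manifold of dimension $n$ and let $p\in\{1,\dots,n-1\}$. For a $(1,1)$-form $\gamma\ge 0$ put $\gamma_p:=\gamma^p/p!$. A *Hermitian metric* on $X$ is a $C^\infty$ positive definite $(1,1)$-form $\omega$ on $X$. *Partially $p$-Kähler hyperbolic structure.* This is a triple $(E,\Omega,\omega=\omega_E+\omega_{nE})$ where $E\subset T^{1,0}X$ is a $C^\infty$ complex vector subbundle of rank $\ge p$, and $\omega_E\ge 0$, $\omega_{nE}\ge 0$ are positive semi-definite $C^\infty$ $(1,1)$-forms on $X$ such that: (i) $\omega:=\omega_E+\omega_{nE}$ is positive definite on $X$; (ii) $\omega_E(x)(\xi,\bar\xi)>0$ for all $x\in X$ and all $\xi\in E_x\setminus\{0\}$; (iii) $\omega_{nE}(x)(\xi,\bar\eta)=0$ for all $x\in X$ and all $\xi,\eta\in E_x$; (iv) $\Omega:=\omega_E^p/p!$ satisfies $d\Omega=0$ and is $\tilde d$(bounded): if $\pi_X:\widetilde X\to X$ is the universal covering, there is a $C^\infty$ form $\widetilde\Gamma$ of degree $2p-1$ on $\widetilde X$, bounded with respect to $\pi_X^\star\omega$,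 with $\pi_X^\star\Omega=d\widetilde\Gamma$. *Volume and area.* Let $f:\mathbb C^p\to X$ be a holomorphic map that is non-degenerate (i.e. has injective differential) at some point, let $\omega$ be a Hermitian metric on $X$, and let $B_r$, $S_r\subset\mathbb C^p$ be the Euclidean ball and sphere of radius $r$ centred at $0$. Put $$\mathrm{Vol}_{\omega,f}(B_r):=\int_{B_r}f^\star\omega_p,\qquad A_{\omega,f}(S_r):=\int_{S_r}\star_{f^\star\omega}\!\Big(\frac{d\tau}{|d\tau|_{f^\star\omega}}\Big),\qquad \tau(z)=|z|^2,$$ where the norm and the Hodge star are those of the metric $f^\star\omega$ (with volume form $f^\star\omega_p$) on the set where $f$ is non-degenerate; the integrand of $A_{\omega,f}(S_r)$ is taken to be $0$ at the points where $f$ is degenerate. *Strong partial $p$-hyperbolicity.* $X$ is *strongly partially $p$-hyperbolic in the $E$-directions* if there is no holomorphic map $f:\mathbb C^p\to X$ such that (a) $f$ is non-degenerate at some point of $\mathbb C^p$; (b) $f$ is $E$-horizontal: $d_zf(\mathbb C^p)\subset E_{f(z)}$ for every $z\in\mathbb C^p$; (c) for some Hermitian metric $\omega$ on $X$, $\displaystyle\liminf_{r\to+\infty}\frac{A_{\omega,f}(S_r)}{\mathrm{Vol}_{\omega,f}(B_r)}=0$.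 *Ahlfors current.* For $f$ and $\omega$ as above, a current $T$ on $X$ is an *Ahlfors current induced by $f$* if $dT=0$ and $T$ is the weak limit of the currents $T_{r_\nu}=\frac{1}{\mathrm{Vol}_{\omega,f}(B_{r_\nu})}f_\star[B_{r_\nu}]$ for some sequence $r_\nu\to+\infty$. **Theorem.** If $X$ has a partially $p$-Kähler hyperbolic structure $(E,\Omega,\omega=\omega_E+\omega_{nE})$, then $X$ is strongly partially $p$-hyperbolic in the $E$-directions. In particular, there is no Ahlfors current on $X$ (with respect to any Hermitian metric) induced by a holomorphic map $f:\mathbb C^p\to X$ satisfying (a), (b) and (c). -/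

import Mathlib

open scoped Manifold ContDiff Topology
open MeasureTheory Filter

universe u

noncomputable section

namespace PartialHyp

/-- The complex Euclidean space of dimension `n`. -/
abbrev Cn (n : ℕ) : Type := EuclideanSpace ℂ (Fin n)

/-! ### Linear algebra: divided powers, interior product, Hodge star of a covector -/

theorem pair_update {n m : ℕ} [DecidableEq (Fin (2 * m))] (v : Fin (2 * m) → Cn n)
    (j : Fin (2 * m)) (x : Cn n) (i : Fin m) (h₀ : 2 * (i : ℕ) < 2 * m)
    (h₁ : 2 * (i : ℕ) + 1 < 2 * m) :
    (![Function.update v j x ⟨2 * i, h₀⟩, Function.update v j x ⟨2 * i + 1, h₁⟩] :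
        Fin 2 → Cn n) =
      if (j : ℕ) / 2 = i then
        Function.update ![v ⟨2 * i, h₀⟩, v ⟨2 * i + 1, h₁⟩] ⟨j % 2, by omega⟩ x
      else ![v ⟨2 * i, h₀⟩, v ⟨2 * i + 1, h₁⟩] := by
  funext l
  split_ifs with h <;> fin_cases l <;>
    simp [Function.update_apply, Fin.ext_iff] <;> grind

/-- The `2m`-linear map `(v₀, …, v₂ₘ₋₁) ↦ ∏ᵢ η (v₂ᵢ, v₂ᵢ₊₁)`. -/
def pairProduct {n : ℕ} (m : ℕ) (η : Cn n [⋀^Fin 2]→L[ℝ] ℝ) :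
    ContinuousMultilinearMap ℝ (fun _ : Fin (2 * m) => Cn n) ℝ where
  toFun v := ∏ i : Fin m, η ![v ⟨2 * i, by omega⟩, v ⟨2 * i + 1, by omega⟩]
  map_update_add' := by
    intro inst v j x y
    have hj : (j : ℕ) / 2 < m := by omega
    simp only [pair_update]
    rw [← Finset.mul_prod_erase _ _ (Finset.mem_univ (⟨j / 2, hj⟩ : Fin m)),
      ← Finset.mul_prod_erase _ _ (Finset.mem_univ (⟨j / 2, hj⟩ : Fin m)),
      ← Finset.mul_prod_erase _ _ (Finset.mem_univ (⟨j / 2, hj⟩ : Fin m))]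
    simp only [if_true, ContinuousAlternatingMap.map_update_add]
    rw [add_mul]
    congr 2 <;>
    · refine Finset.prod_congr rfl fun i hi => ?_
      have : (j : ℕ) / 2 ≠ i := fun h => (Finset.mem_erase.1 hi).1 (Fin.ext h.symm)
      simp [this]
  map_update_smul' := by
    intro inst v j c x
    have hj : (j : ℕ) / 2 < m := by omega
    simp only [pair_update]
    rw [← Finset.mul_prod_erase _ _ (Finset.mem_univ (⟨j / 2, hj⟩ : Fin m)),
      ← Finset.mul_prod_erase _ _ (Finset.mem_univ (⟨j / 2, hj⟩ : Fin m))]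
    simp only [if_true, ContinuousAlternatingMap.map_update_smul]
    rw [smul_mul_assoc]
    congr 2
    refine Finset.prod_congr rfl fun i hi => ?_
    have : (j : ℕ) / 2 ≠ i := fun h => (Finset.mem_erase.1 hi).1 (Fin.ext h.symm)
    simp [this]
  cont := by
    refine continuous_finsetProd _ fun i _ => η.cont.comp (continuous_pi fun l => ?_)
    fin_cases l
    · exact continuous_apply _
    · exact continuous_apply _

/-- The divided power `η ^ m / m!` (with respect to the wedge product) of an alternating
`2`-form `η`, written out as
`(η ^ m / m!) (v₀, …, v₂ₘ₋₁) = (2 ^ m m!)⁻¹ ∑_σ sign σ ∏ᵢ η (v_σ(2i), v_σ(2i+1))`,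
the sum running over all permutations `σ` of the `2m` indices.  (The wedge product is normalised
so that `(dx ∧ dy) (∂x, ∂y) = 1`.) -/
def dividedPower {n : ℕ} (m : ℕ) (η : Cn n [⋀^Fin 2]→L[ℝ] ℝ) : Cn n [⋀^Fin (2 * m)]→L[ℝ] ℝ :=
  ((2 ^ m * m.factorial : ℝ)⁻¹) • ContinuousMultilinearMap.alternatization (pairProduct m η)

theorem dividedPower_apply {n m : ℕ} (η : Cn n [⋀^Fin 2]→L[ℝ] ℝ) (v : Fin (2 * m) → Cn n) :
    dividedPower m η v = ((2 ^ m * m.factorial : ℝ)⁻¹) *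
      ∑ σ : Equiv.Perm (Fin (2 * m)), ((Equiv.Perm.sign σ : ℤ) : ℝ) *
        ∏ i : Fin m, η ![v (σ ⟨2 * i, by omega⟩), v (σ ⟨2 * i + 1, by omega⟩)] := by
  simp only [dividedPower, ContinuousAlternatingMap.smul_apply, smul_eq_mul]
  congr 1
  simp [ContinuousMultilinearMap.alternatization, pairProduct, Units.smul_def,
    ContinuousMultilinearMap.domDomCongr]
  rfl

/-- The interior product `ι_w α = α (w, ·, …, ·)`; it is zero on forms of degree zero. -/
def interior {n : ℕ} (w : Cn n) :
    {k : ℕ} → (Cn n [⋀^Fin k]→L[ℝ] ℝ) → (Cn n [⋀^Fin (k - 1)]→L[ℝ] ℝ)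
  | 0, _ => 0
  | _ + 1, α => α.curryLeft w

theorem update_pair_zero {V : Type*} (a b w : V) : Function.update ![a, b] 0 w = ![w, b] := by
  funext l; fin_cases l <;> simp

theorem update_pair_one {V : Type*} (a b w : V) : Function.update ![a, b] 1 w = ![a, w] := by
  funext l; fin_cases l <;> simp

/-- The real bilinear form `g (u, v) = η (u, i v)` attached to a `2`-form `η`. When `η` is a
positive definite `(1,1)`-form, this is the Riemannian metric of `η`. -/
def metricForm {n : ℕ} (η : Cn n [⋀^Fin 2]→L[ℝ] ℝ) : LinearMap.BilinForm ℝ (Cn n) :=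
  LinearMap.mk₂ ℝ (fun u v => η ![u, Complex.I • v])
    (fun u u' v => by simpa only [update_pair_zero] using η.map_update_add ![u, Complex.I • v] 0 u u')
    (fun c u v => by simpa only [update_pair_zero] using η.map_update_smul ![u, Complex.I • v] 0 c u)
    (fun u v v' => by
      simpa only [update_pair_one, smul_add] using
        η.map_update_add ![u, Complex.I • v] 1 (Complex.I • v) (Complex.I • v'))
    (fun c u v => by
      rw [smul_comm]
      simpa only [update_pair_one] using
        η.map_update_smul ![u, Complex.I • v] 1 c (Complex.I • v))

open Classical in
/-- The vector dual to the covector `θ` for the metric of `η`, namely the `w` with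
`g (w, v) = θ v` for all `v`. It is set to zero when the metric is degenerate. -/
def sharp {n : ℕ} (η : Cn n [⋀^Fin 2]→L[ℝ] ℝ) (θ : Cn n →L[ℝ] ℝ) : Cn n :=
  if h : (metricForm η).Nondegenerate then ((metricForm η).toDual h).symm θ.toLinearMap else 0

/-- The norm of a covector for the metric of `η`. -/
def covectorNorm {n : ℕ} (η : Cn n [⋀^Fin 2]→L[ℝ] ℝ) (θ : Cn n →L[ℝ] ℝ) : ℝ :=
  √(θ (sharp η θ))

/-- The Hodge star of a covector on `ℂᵖ`, for the metric and the volume form `η ^ p / p!` of `η`: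
`⋆ θ` is the contraction of the volume form with the vector dual to `θ`, so that
`α ∧ ⋆ θ = ⟨α, θ⟩ η ^ p / p!` for all covectors `α`. -/
def hodgeStar {p : ℕ} (η : Cn p [⋀^Fin 2]→L[ℝ] ℝ) (θ : Cn p →L[ℝ] ℝ) :
    Cn p [⋀^Fin (2 * p - 1)]→L[ℝ] ℝ :=
  interior (sharp η θ) (dividedPower p η)

/-! ### Differential forms on complex manifolds -/

/-- Real differential forms of degree `k` (not necessarily continuous) on an `n`-dimensional
complex manifold `X`. The tangent space of `X` at `x` is, as always in Mathlib, the model space,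
identified with it through the derivative of the preferred chart at `x`; multiplication by `i`
on it is the complex structure of `X`. -/
abbrev DiffForm (X : Type*) (n k : ℕ) : Type _ := X → Cn n [⋀^Fin k]→L[ℝ] ℝ

/-- The (complex linear) differential of a holomorphic map between complex manifolds. -/
def dif {M N : Type*} {m n : ℕ} [TopologicalSpace M] [ChartedSpace (Cn m) M]
    [TopologicalSpace N] [ChartedSpace (Cn n) N] (f : M → N) (z : M) : Cn m →L[ℂ] Cn n :=
  mfderiv 𝓘(ℂ, Cn m) 𝓘(ℂ, Cn n) f z

/-- The pullback of a differential form under a holomorphic map. -/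
def pullback {M N : Type*} {m n k : ℕ} [TopologicalSpace M] [ChartedSpace (Cn m) M]
    [TopologicalSpace N] [ChartedSpace (Cn n) N] (f : M → N) (α : DiffForm N n k) :
    DiffForm M m k :=
  fun z => (α (f z)).compContinuousLinearMap ((dif f z).restrictScalars ℝ)

section Forms

variable {X : Type*} {n : ℕ} [TopologicalSpace X] [ChartedSpace (Cn n) X]

/-- A form is smooth if all its local expressions in the charts are (real) `C^∞`. -/
def IsSmoothForm {k : ℕ} (α : DiffForm X n k) : Prop :=
  ∀ x : X, ContDiffOn ℝ ∞ (pullback (m := n) (chartAt (Cn n) x).symm α) (chartAt (Cn n) x).target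

/-- The exterior derivative, computed at each point in the preferred chart. -/
def extD {k : ℕ} (α : DiffForm X n k) : DiffForm X n (k + 1) := fun x =>
  pullback (n := n) (chartAt (Cn n) x)
    (extDeriv (pullback (m := n) (chartAt (Cn n) x).symm α)) x

/-- A smooth positive semi-definite `(1,1)`-form: a smooth real `2`-form that is invariant under
the complex structure and satisfies `η (u, i u) ≥ 0`. -/
structure IsSemiPositive (η : DiffForm X n 2) : Prop where
  smooth : IsSmoothForm η
  invariant : ∀ x u v, η x ![Complex.I • u, Complex.I • v] = η x ![u, v]
  nonneg : ∀ x u, 0 ≤ η x ![u, Complex.I • u]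

/-- A Hermitian metric: a smooth positive definite `(1,1)`-form. -/
structure IsHermitianMetric (η : DiffForm X n 2) : Prop extends IsSemiPositive η where
  pos : ∀ x u, u ≠ 0 → 0 < η x ![u, Complex.I • u]

/-- `β` is bounded with respect to (the metric of) `η`. -/
def IsBoundedForm {k : ℕ} (η : DiffForm X n 2) (β : DiffForm X n k) : Prop :=
  ∃ C : ℝ, ∀ x v, |β x v| ≤ C * ∏ i, √(η x ![v i, Complex.I • v i])

/-- `α` is `d`(bounded) with respect to `η`: it is the exterior derivative of a smooth
`η`-bounded form. -/
def IsDBounded {K : ℕ} (η : DiffForm X n 2) (α : DiffForm X n K) : Prop :=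
  ∃ (k : ℕ) (h : k + 1 = K) (β : DiffForm X n k), IsSmoothForm β ∧ IsBoundedForm η β ∧
    ∀ x v, α x v = extD β x (v ∘ Fin.cast h)

end Forms

/-- `π : Y → X` is the universal covering map of the complex manifold `X`, where `Y` carries the
complex structure lifted from `X`. -/
structure IsUniversalCovering {X Y : Type*} (n : ℕ) [TopologicalSpace X] [ChartedSpace (Cn n) X]
    [TopologicalSpace Y] [ChartedSpace (Cn n) Y] (π : Y → X) : Prop where
  isManifold : IsManifold 𝓘(ℂ, Cn n) ω Y
  simplyConnected : SimplyConnectedSpace Y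
  isCoveringMap : IsCoveringMap π
  surjective : Function.Surjective π
  isLocalDiffeomorph : IsLocalDiffeomorph 𝓘(ℂ, Cn n) 𝓘(ℂ, Cn n) ω π

/-- `α` is `d̃`(bounded) with respect to `η`: its lift to the universal cover is `d`(bounded) with
respect to the lift of `η`. (The universal cover is unique up to isomorphism over `X`.) -/
def IsDTildeBounded {X : Type u} {n K : ℕ} [TopologicalSpace X] [ChartedSpace (Cn n) X]
    (η : DiffForm X n 2) (α : DiffForm X n K) : Prop :=
  ∃ (Y : Type u) (_ : TopologicalSpace Y) (_ : ChartedSpace (Cn n) Y) (π : Y → X),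
    IsUniversalCovering n π ∧ IsDBounded (pullback (m := n) π η) (pullback (m := n) π α)

/-! ### Subbundles and hyperbolic structures -/

/-- A `C^∞` complex vector subbundle of the holomorphic tangent bundle `T^{1,0}X`, the latter being
identified with the tangent bundle with its complex structure: near each point, in the chart at
that point, the fibres are spanned by a frame of smooth (in the real sense) vector fields that are
pointwise linearly independent over `ℂ`. -/
structure SmoothSubbundle (X : Type*) (n : ℕ) [TopologicalSpace X] [ChartedSpace (Cn n) X] where
  /-- the fibres -/
  fiber : X → Submodule ℂ (Cn n)
  /-- the rank -/
  rank : ℕ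
  exists_frame : ∀ x₀ : X, ∃ W : Set (Cn n), IsOpen W ∧ chartAt (Cn n) x₀ x₀ ∈ W ∧
    W ⊆ (chartAt (Cn n) x₀).target ∧ ∃ s : Fin rank → Cn n → Cn n,
      (∀ i, ContDiffOn ℝ ∞ (s i) W) ∧
      ∀ u ∈ W, LinearIndependent ℂ (fun i => s i u) ∧
        fiber ((chartAt (Cn n) x₀).symm u) =
          (Submodule.span ℂ (Set.range fun i => s i u)).map
            (dif (m := n) (n := n) (chartAt (Cn n) x₀).symm u).toLinearMap

/-- A partially `p`-Kähler hyperbolic structure `(E, Ω, ω = ω_E + ω_nE)` on `X`. For `u`, `v` in a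
fibre of `E`, the Hermitian form of `ω_nE` at `(u, v)` has real and imaginary parts
`ω_nE (u, i v)` and, up to sign, `ω_nE (u, v)`; as the fibres are complex subspaces, it vanishes on
them if and only if the `2`-form `ω_nE` does. -/
structure PartialKahlerHyperbolicStructure (X : Type u) (n p : ℕ)
    [TopologicalSpace X] [ChartedSpace (Cn n) X] where
  /-- the horizontal bundle -/
  E : SmoothSubbundle X n
  le_rank : p ≤ E.rank
  /-- the form `ω_E` -/
  omE : DiffForm X n 2
  /-- the form `ω_nE` -/
  omNE : DiffForm X n 2
  omE_semiPositive : IsSemiPositive omE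
  omNE_semiPositive : IsSemiPositive omNE
  hermitian : IsHermitianMetric (omE + omNE)
  omE_pos : ∀ x, ∀ u ∈ E.fiber x, u ≠ 0 → 0 < omE x ![u, Complex.I • u]
  omNE_zero : ∀ x, ∀ u ∈ E.fiber x, ∀ v ∈ E.fiber x, omNE x ![u, v] = 0
  closed : extD (fun x => dividedPower p (omE x)) = 0
  dTildeBounded : IsDTildeBounded (omE + omNE) (fun x => dividedPower p (omE x))

/-! ### Integrals over balls and spheres of `ℂᵖ`, volume and area -/

/-- The positively oriented real orthonormal basis `e₁, i e₁, e₂, i e₂, …` of `ℂᵖ`, numbered from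
zero (and continued by zero). -/
def stdFrame (p k : ℕ) : Cn p :=
  if h : k / 2 < p then
    EuclideanSpace.single ⟨k / 2, h⟩ (if k % 2 = 0 then 1 else Complex.I)
  else 0

/-- The integral of a form of top degree over the ball `B_r` centred at the origin of `ℂᵖ`. -/
def ballIntegral {p : ℕ} (Θ : DiffForm (Cn p) p (2 * p)) (r : ℝ) : ℝ :=
  ∫ z in Metric.ball (0 : Cn p) r, Θ z (fun k => stdFrame p k)

/-- The integral of a form `ζ` of degree `2p - 1` over the sphere `S_r`, oriented as the boundary of
the ball `B_r`, in `ℂᵖ`. The restriction of `ζ` to `S_r` is the Euclidean surface measure times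
the value of `ν ∧ ζ` on the positive orthonormal basis, `ν` being the outer unit conormal. The
surface measure of `S_r` is `r ^ (2p - 1)` times that of the unit sphere. -/
def sphereIntegral {p : ℕ} (ζ : DiffForm (Cn p) p (2 * p - 1)) (r : ℝ) : ℝ :=
  r ^ (2 * p - 1) * ∫ w : Metric.sphere (0 : Cn p) 1,
    ∑ j ∈ Finset.range (2 * p), (-1) ^ j * inner ℝ (stdFrame p j) (w : Cn p) *
      ζ (r • (w : Cn p)) (fun l => stdFrame p (if (l : ℕ) < j then l else l + 1))
    ∂(volume : Measure (Cn p)).toSphere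

section Maps

variable {X : Type*} {n p : ℕ} [TopologicalSpace X] [ChartedSpace (Cn n) X]

/-- `Vol_{ω,f}(B_r)`, the integral over `B_r` of `f^* (ω ^ p / p!)`. -/
def mapVolume (η : DiffForm X n 2) (f : Cn p → X) (r : ℝ) : ℝ :=
  ballIntegral (pullback (m := p) f (fun x => dividedPower p (η x))) r

/-- The area measure `dσ_{ω,f} = ⋆ (dτ / |dτ|)`, where `τ = |z|²` and the norm and the star are
those of the degenerate metric `f^* ω`. (It is zero at the points where `f` is degenerate.) -/
def areaForm (η : DiffForm X n 2) (f : Cn p → X) : DiffForm (Cn p) p (2 * p - 1) := fun z =>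
  let γ := pullback (m := p) f η z
  let dτ : Cn p →L[ℝ] ℝ := fderiv ℝ (fun z : Cn p => ‖z‖ ^ 2) z
  hodgeStar γ ((covectorNorm γ dτ)⁻¹ • dτ)

/-- `A_{ω,f}(S_r)`. -/
def mapArea (η : DiffForm X n 2) (f : Cn p → X) (r : ℝ) : ℝ :=
  sphereIntegral (areaForm η f) r

/-- The growth condition `liminf_{r → ∞} A_{ω,f}(S_r) / Vol_{ω,f}(B_r) = 0`. -/
def GrowthCondition (η : DiffForm X n 2) (f : Cn p → X) : Prop :=
  liminf (fun r : ℝ => ((mapArea η f r / mapVolume η f r : ℝ) : EReal)) atTop = 0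

/-- The maps `f : ℂᵖ → X` that strong partial `p`-hyperbolicity in the `E`-directions excludes. -/
structure IsExcludedMap (E : SmoothSubbundle X n) (f : Cn p → X) : Prop where
  holomorphic : ContMDiff 𝓘(ℂ, Cn p) 𝓘(ℂ, Cn n) ω f
  nondegenerate : ∃ z, Function.Injective (dif (m := p) (n := n) f z)
  horizontal : ∀ z v, dif (m := p) (n := n) f z v ∈ E.fiber (f z)
  growth : ∃ η : DiffForm X n 2, IsHermitianMetric η ∧ GrowthCondition η f

/-- Strong partial `p`-hyperbolicity in the `E`-directions. -/
def StronglyPartiallyHyperbolic (p : ℕ) (E : SmoothSubbundle X n) : Prop :=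
  ¬ ∃ f : Cn p → X, IsExcludedMap E f

end Maps

/-! ### Ahlfors currents -/

theorem pullback_add {M N : Type*} {m n k : ℕ} [TopologicalSpace M] [ChartedSpace (Cn m) M]
    [TopologicalSpace N] [ChartedSpace (Cn n) N] (f : M → N) (α β : DiffForm N n k) :
    pullback (m := m) f (α + β) = pullback (m := m) f α + pullback (m := m) f β := rfl

theorem pullback_smul {M N : Type*} {m n k : ℕ} [TopologicalSpace M] [ChartedSpace (Cn m) M]
    [TopologicalSpace N] [ChartedSpace (Cn n) N] (f : M → N) (c : ℝ) (α : DiffForm N n k) :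
    pullback (m := m) f (c • α) = c • pullback (m := m) f α := rfl

/-- The space of smooth real forms of degree `k` on `X`. -/
def smoothForms (X : Type*) (n k : ℕ) [TopologicalSpace X] [ChartedSpace (Cn n) X] :
    Submodule ℝ (DiffForm X n k) where
  carrier := {α | IsSmoothForm α}
  add_mem' {α β} ha hb := fun x => by
    rw [pullback_add]; exact (ha x).add (hb x)
  zero_mem' := fun x => by
    have : pullback (m := n) (chartAt (Cn n) x).symm (0 : DiffForm X n k) = 0 := rfl
    rw [this]; exact contDiffOn_const
  smul_mem' c α ha := fun x => by
    rw [pullback_smul]; exact contDiffOn_const.smul (ha x)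

/-- `T` is an Ahlfors current induced by `f : ℂᵖ → (X, η)`: it is the weak limit of the currents
`T_r = Vol_{η,f}(B_r)⁻¹ f_* [B_r]` along some sequence of radii tending to infinity, and `d T = 0`.
Currents of bidimension `(p,p)` act here on all smooth real `2p`-forms (by zero on the components
of bidegree other than `(p,p)`). Continuity of `T`, as well as its bidegree, its positivity and its
mass, are consequences of its being such a limit. -/
def IsAhlforsCurrent {X : Type*} {n p : ℕ} [TopologicalSpace X] [ChartedSpace (Cn n) X]
    (η : DiffForm X n 2) (f : Cn p → X) (T : smoothForms X n (2 * p) →ₗ[ℝ] ℝ) : Prop :=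
  (∃ r : ℕ → ℝ, (∀ ν, 0 < r ν) ∧ Tendsto r atTop atTop ∧
    ∀ φ : smoothForms X n (2 * p),
      Tendsto (fun ν => (mapVolume η f (r ν))⁻¹ * ballIntegral (pullback (m := p) f φ.1) (r ν))
        atTop (𝓝 (T φ))) ∧
  ∀ (k : ℕ) (h : k + 1 = 2 * p) (ψ : smoothForms X n k) (φ : smoothForms X n (2 * p)),
    (∀ x v, φ.1 x v = extD ψ.1 x (v ∘ Fin.cast h)) → T φ = 0

end PartialHyp

end

open PartialHyp

/-!
Let `f : ℂᵖ → X` be holomorphic, horizontal and somewhere non-degenerate, and let `η` be any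
Hermitian metric on the compact manifold `X`. The theorem follows from the isoperimetric inequality
`Vol_{η,f}(B_r) ≤ K · A_{η,f}(S_r)` for all `r > 0`, with `K` independent of `r`
(`exists_mapVolume_le`): since the volume of large balls is positive (`mapVolume_pos`), the quotient
of area by volume is eventually at least `1 / K`, and its lower limit cannot be zero. Maps inducing
Ahlfors currents are covered because the growth condition is part of what is assumed of them.

For the inequality, let `ω = ω_E + ω_nE`. Since `X` is compact, `ω` and `η` are comparable
(`exists_form_le`), so the volume may be computed with `ω`, at the expense of a constant
(`dividedPower_stdFrame_le`). As `f` is horizontal, `f^* ω = f^* ω_E`, and thus the volume form of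
`f^* ω` is `f^* Ω`. The map `f` lifts to the universal covering (`exists_lift`), where `Ω` becomes
the exterior derivative of a bounded form `Γ`; so the volume form of `f^* ω` is `dζ`, with `ζ` the
pullback of `Γ` (`extDeriv_pullback_eq`). By Stokes' theorem on the ball (`integral_ball_extDeriv`),
the volume of `B_r` is the flux of `ζ` through `S_r`, and the flux density of a bounded form is at
most a constant times the density of the area form (`abs_fluxDensity_le`).

The pointwise estimates rest on two facts. A positive semi-definite form of type `(1,1)` on `ℂᵖ` is
the pullback of the standard Kähler form under a complex linear map `g` (`exists_eq_im_inner`), and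
so its volume form has density `|det g|² · c` with a constant `c > 0` (`dividedPower_stdFrame`,
`stdVolume_pos`). Consequently a form of top degree that is bounded for a metric is at most a multiple
of the volume form of this metric (`abs_topForm_le`). The points where `f` is degenerate have to be
included in all of this, as the area is an integral over the whole sphere; there the flux density of
`ζ` vanishes. For the integral to be meaningful, the area density has to be integrable: it is
bounded (`areaDensity_le`), and measurable because the vector dual to a covector is given by the
inverse of the Gram matrix (`inner_sharp_eq`).

Stokes' theorem on the ball is deduced from integration by parts against smooth radial cutoff
functions, in polar coordinates (`integral_ball_sum_fderiv`).
-/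

namespace PartialHyp

/-! ### The standard frame -/

theorem stdFrame_two_mul {p : ℕ} (i : Fin p) :
    stdFrame p (2 * i) = EuclideanSpace.single i 1 := by
  have h : 2 * (i : ℕ) / 2 = i := by omega
  simp [stdFrame, h]

theorem stdFrame_two_mul_add_one {p : ℕ} (i : Fin p) :
    stdFrame p (2 * i + 1) = EuclideanSpace.single i Complex.I := by
  have h : (2 * (i : ℕ) + 1) / 2 = i := by omega
  have h' : (2 * (i : ℕ) + 1) % 2 = 1 := by omega
  simp [stdFrame, h, h']

theorem inner_real_eq_re {p : ℕ} (x y : Cn p) : inner ℝ x y = (inner ℂ x y).re := by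
  simp [PiLp.inner_apply]

/-- The pairs `(i, b)` number the standard frame as `stdFrame p (2 * i + b)`. -/
def frameEquiv (p : ℕ) : Fin p × Fin 2 ≃ Fin (2 * p) :=
  finProdFinEquiv.trans (finCongr (mul_comm p 2))

theorem frameEquiv_val {p : ℕ} (x : Fin p × Fin 2) :
    (frameEquiv p x : ℕ) = 2 * (x.1 : ℕ) + x.2 := by
  simp [frameEquiv, finProdFinEquiv]; ring

theorem stdFrame_frameEquiv {p : ℕ} (x : Fin p × Fin 2) :
    stdFrame p (frameEquiv p x) =
      EuclideanSpace.single x.1 (if x.2 = 0 then 1 else Complex.I) := by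
  obtain ⟨i, b⟩ := x
  rw [frameEquiv_val]
  fin_cases b
  · simpa using stdFrame_two_mul i
  · simpa using stdFrame_two_mul_add_one i

theorem inner_stdFrame_frameEquiv {p : ℕ} (x y : Fin p × Fin 2) :
    inner ℂ (stdFrame p (frameEquiv p x)) (stdFrame p (frameEquiv p y)) =
      if x.1 = y.1 then (if x.2 = y.2 then 1 else if x.2 = 0 then Complex.I else -Complex.I)
      else 0 := by
  obtain ⟨i, b⟩ := x
  obtain ⟨j, c⟩ := y
  simp only [stdFrame_frameEquiv, EuclideanSpace.inner_single_left]
  by_cases hij : i = j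
  · subst hij
    fin_cases b <;> fin_cases c <;> simp
  · simp [hij]

theorem orthonormal_stdFrame (p : ℕ) :
    Orthonormal ℝ (fun k : Fin (2 * p) => stdFrame p k) := by
  rw [orthonormal_iff_ite]
  intro i j
  obtain ⟨x, rfl⟩ := (frameEquiv p).surjective i
  obtain ⟨y, rfl⟩ := (frameEquiv p).surjective j
  rw [inner_real_eq_re, inner_stdFrame_frameEquiv]
  simp only [EmbeddingLike.apply_eq_iff_eq, Prod.ext_iff]
  split_ifs <;> simp_all

theorem finrank_real_Cn (p : ℕ) : Module.finrank ℝ (Cn p) = 2 * p := by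
  rw [finrank_real_of_complex]; simp

/-- The standard frame as a real orthonormal basis of `ℂᵖ`. -/
noncomputable def stdBasis (p : ℕ) : OrthonormalBasis (Fin (2 * p)) ℝ (Cn p) :=
  OrthonormalBasis.mk (orthonormal_stdFrame p) (by
    have h := (orthonormal_stdFrame p).linearIndependent.span_eq_top_of_card_eq_finrank'
      (by rw [finrank_real_Cn, Fintype.card_fin])
    exact h.ge)

theorem stdBasis_apply {p : ℕ} (k : Fin (2 * p)) : stdBasis p k = stdFrame p k := by
  simp [stdBasis]

theorem norm_stdFrame {p : ℕ} (k : Fin (2 * p)) : ‖stdFrame p k‖ = 1 :=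
  (orthonormal_stdFrame p).1 k

/-! ### The volume form of the standard metric -/

/-- The value on the standard frame of the `p`-th divided power of the standard Kähler form
`(u, v) ↦ Im ⟨u, v⟩`. -/
noncomputable def stdVolume (p : ℕ) : ℝ :=
  (2 ^ p * p.factorial : ℝ)⁻¹ *
    ∑ σ : Equiv.Perm (Fin (2 * p)), ((Equiv.Perm.sign σ : ℤ) : ℝ) *
      ∏ i : Fin p, (inner ℂ (stdFrame p (σ ⟨2 * i, by omega⟩))
        (stdFrame p (σ ⟨2 * i + 1, by omega⟩))).im

theorem im_inner_stdFrame_frameEquiv {p : ℕ} (x y : Fin p × Fin 2) :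
    (inner ℂ (stdFrame p (frameEquiv p x)) (stdFrame p (frameEquiv p y))).im =
      if x.1 = y.1 then (if x.2 = y.2 then 0 else if x.2 = 0 then 1 else -1) else 0 := by
  rw [inner_stdFrame_frameEquiv]
  split_ifs <;> simp

/-- A permutation of `Fin p × Fin 2` that maps every pair `{(i, 0), (i, 1)}` to such a pair has
as its sign the product of the signs with which it acts on the pairs: moving the pairs around is an
even permutation. -/
theorem sign_mul_prod_nonneg {p : ℕ} (τ : Equiv.Perm (Fin p × Fin 2)) :
    0 ≤ ((Equiv.Perm.sign τ : ℤ) : ℝ) * ∏ i : Fin p,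
      (if (τ (i, 0)).1 = (τ (i, 1)).1 then
        (if (τ (i, 0)).2 = (τ (i, 1)).2 then (0 : ℝ) else if (τ (i, 0)).2 = 0 then 1 else -1)
      else 0) := by
  classical
  by_cases hz : ∃ i, (if (τ (i, 0)).1 = (τ (i, 1)).1 then
        (if (τ (i, 0)).2 = (τ (i, 1)).2 then (0 : ℝ) else if (τ (i, 0)).2 = 0 then 1 else -1)
      else 0) = 0
  · obtain ⟨i, hi⟩ := hz
    rw [Finset.prod_eq_zero (Finset.mem_univ i) hi, mul_zero]
  push Not at hz
  have h1 : ∀ i, (τ (i, 0)).1 = (τ (i, 1)).1 := fun i => by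
    by_contra h; exact hz i (by simp [h])
  have h2 : ∀ i, (τ (i, 0)).2 ≠ (τ (i, 1)).2 := fun i h => hz i (by simp [h])
  have hinj : Function.Injective fun i => (τ (i, 0)).1 := by
    intro i j hij
    have hij' : (τ (i, 0)).1 = (τ (j, 0)).1 := hij
    by_cases hs : (τ (i, 0)).2 = (τ (j, 0)).2
    · exact (Prod.ext_iff.1 (τ.injective (Prod.ext hij' hs))).1
    · have : (τ (i, 1)).2 = (τ (j, 0)).2 := by have := h2 i; omega
      exact (Prod.ext_iff.1 (τ.injective (Prod.ext ((h1 i).symm.trans hij') this))).1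
  -- `ρ` is the induced permutation of the pairs, and `φ i` tells whether the `i`-th pair is flipped.
  let ρ : Equiv.Perm (Fin p) := Equiv.ofBijective _ (Finite.injective_iff_bijective.1 hinj)
  let φ : Fin p → Equiv.Perm (Fin 2) := fun i =>
    if (τ (i, 0)).2 = 0 then 1 else Equiv.swap 0 1
  have hτ : τ = Equiv.prodCongrLeft (fun _ : Fin 2 => ρ) * Equiv.prodCongrRight φ := by
    refine Equiv.ext fun ⟨i, b⟩ => ?_
    have h1i := h1 i
    have h2i := h2 i
    refine Prod.ext ?_ ?_
    · change _ = (τ (i, 0)).1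
      fin_cases b
      · rfl
      · exact h1i.symm
    · change _ = φ i b
      simp only [φ]
      fin_cases b <;> split_ifs with h0 <;> simp <;> omega
  rw [hτ, map_mul, Equiv.Perm.sign_prodCongrLeft, Equiv.Perm.sign_prodCongrRight]
  simp only [Finset.prod_const, Finset.card_univ, Fintype.card_fin, Int.units_sq, one_mul]
  rw [Units.coe_prod, Int.cast_prod, ← hτ, ← Finset.prod_mul_distrib]
  refine Finset.prod_nonneg fun i _ => ?_
  rw [if_pos (h1 i), if_neg (h2 i)]
  simp only [φ]
  split_ifs <;> simp

theorem stdVolume_pos (p : ℕ) : 0 < stdVolume p := by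
  have key : ∀ σ : Equiv.Perm (Fin (2 * p)), ((Equiv.Perm.sign σ : ℤ) : ℝ) *
      ∏ i : Fin p, (inner ℂ (stdFrame p (σ ⟨2 * i, by omega⟩))
        (stdFrame p (σ ⟨2 * i + 1, by omega⟩))).im =
      ((Equiv.Perm.sign ((frameEquiv p).symm.permCongr σ) : ℤ) : ℝ) * ∏ i : Fin p,
      (if (((frameEquiv p).symm.permCongr σ) (i, 0)).1 =
          (((frameEquiv p).symm.permCongr σ) (i, 1)).1 then
        (if (((frameEquiv p).symm.permCongr σ) (i, 0)).2 =
          (((frameEquiv p).symm.permCongr σ) (i, 1)).2 then (0 : ℝ)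
          else if (((frameEquiv p).symm.permCongr σ) (i, 0)).2 = 0 then 1 else -1)
      else 0) := by
    intro σ
    rw [Equiv.Perm.sign_permCongr]
    congr 1
    refine Finset.prod_congr rfl fun i _ => ?_
    rw [← im_inner_stdFrame_frameEquiv]
    have e0 : frameEquiv p (i, 0) = ⟨2 * i, by omega⟩ := Fin.ext (by simp [frameEquiv_val])
    have e1 : frameEquiv p (i, 1) = ⟨2 * i + 1, by omega⟩ := Fin.ext (by simp [frameEquiv_val])
    simp only [Equiv.permCongr_apply, Equiv.symm_symm, Equiv.apply_symm_apply, e0, e1]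
  refine mul_pos (by positivity) (Finset.sum_pos' (fun σ _ => ?_) ⟨1, Finset.mem_univ _, ?_⟩)
  · rw [key]; exact sign_mul_prod_nonneg _
  · rw [key]; simp [Equiv.permCongr_apply]

/-! ### Positive semi-definite forms of type `(1,1)` -/

theorem metricForm_apply {p : ℕ} (γ : Cn p [⋀^Fin 2]→L[ℝ] ℝ) (u v : Cn p) :
    metricForm γ u v = γ ![u, Complex.I • v] := rfl

theorem form_neg_right {p : ℕ} (γ : Cn p [⋀^Fin 2]→L[ℝ] ℝ) (u v : Cn p) :
    γ ![u, -v] = -γ ![u, v] := by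
  simpa only [update_pair_one, neg_one_smul, smul_eq_mul, neg_one_mul] using
    γ.map_update_smul ![u, v] 1 (-1) v

theorem apply_eq_neg_metricForm {p : ℕ} (γ : Cn p [⋀^Fin 2]→L[ℝ] ℝ) (u v : Cn p) :
    γ ![u, v] = -metricForm γ u (Complex.I • v) := by
  rw [metricForm_apply, smul_smul, Complex.I_mul_I, neg_one_smul, form_neg_right, neg_neg]

theorem form_swap {p : ℕ} (γ : Cn p [⋀^Fin 2]→L[ℝ] ℝ) (u v : Cn p) :
    γ ![u, v] = -γ ![v, u] := by
  have := γ.toAlternatingMap.map_swap ![v, u] (show (0 : Fin 2) ≠ 1 by decide)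
  have h : ![v, u] ∘ ⇑(Equiv.swap (0 : Fin 2) 1) = ![u, v] := by
    funext l; fin_cases l <;> simp
  rw [h] at this
  exact this

theorem metricForm_symm {p : ℕ} {γ : Cn p [⋀^Fin 2]→L[ℝ] ℝ}
    (hinv : ∀ u v, γ ![Complex.I • u, Complex.I • v] = γ ![u, v]) (u v : Cn p) :
    metricForm γ u v = metricForm γ v u := by
  rw [metricForm_apply, ← hinv, smul_smul, Complex.I_mul_I, neg_one_smul, form_neg_right,
    ← form_swap, metricForm_apply]

theorem complex_smul_eq {p : ℕ} (c : ℂ) (v : Cn p) :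
    c • v = c.re • v + c.im • (Complex.I • v) := by
  ext j
  simp only [PiLp.add_apply, PiLp.smul_apply, smul_eq_mul, Complex.real_smul]
  conv_lhs => rw [← Complex.re_add_im c]
  ring

/-- The Hermitian form of a `J`-invariant alternating form. -/
noncomputable def hermForm {p : ℕ} (γ : Cn p [⋀^Fin 2]→L[ℝ] ℝ) (u v : Cn p) : ℂ :=
  ⟨metricForm γ u v, γ ![u, v]⟩

theorem hermForm_add_right {p : ℕ} (γ : Cn p [⋀^Fin 2]→L[ℝ] ℝ) (u v w : Cn p) :
    hermForm γ u (v + w) = hermForm γ u v + hermForm γ u w := by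
  simp only [hermForm, apply_eq_neg_metricForm]
  apply Complex.ext <;> simp [add_comm]

theorem hermForm_smul_right {p : ℕ} (γ : Cn p [⋀^Fin 2]→L[ℝ] ℝ) (c : ℂ) (u v : Cn p) :
    hermForm γ u (c • v) = c * hermForm γ u v := by
  simp only [hermForm, apply_eq_neg_metricForm]
  have h2 : metricForm γ u (Complex.I • Complex.I • v) = - metricForm γ u v := by
    rw [smul_smul, Complex.I_mul_I, neg_one_smul, map_neg]
  have h1 : metricForm γ u (c • v) = c.re * metricForm γ u v
      + c.im * metricForm γ u (Complex.I • v) := by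
    conv_lhs => rw [complex_smul_eq]
    simp
  have h3 : metricForm γ u (Complex.I • c • v) = c.re * metricForm γ u (Complex.I • v)
      - c.im * metricForm γ u v := by
    conv_lhs => rw [smul_comm, complex_smul_eq]
    simp only [map_add, map_smul, h2, smul_eq_mul]; ring
  apply Complex.ext
  · simp [h1]
  · simp [h3]; ring

theorem hermForm_conj {p : ℕ} {γ : Cn p [⋀^Fin 2]→L[ℝ] ℝ}
    (hinv : ∀ u v, γ ![Complex.I • u, Complex.I • v] = γ ![u, v]) (u v : Cn p) :
    hermForm γ u v = star (hermForm γ v u) := by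
  apply Complex.ext
  · exact metricForm_symm hinv u v
  · exact form_swap γ u v

/-- A `J`-invariant positive semi-definite alternating form is the pullback of the standard Kähler
form `(u, v) ↦ Im ⟨u, v⟩` under a complex linear map: its Hermitian form is given by a positive
operator, which has a square root. -/
theorem exists_eq_im_inner {p : ℕ} (γ : Cn p [⋀^Fin 2]→L[ℝ] ℝ)
    (hinv : ∀ u v, γ ![Complex.I • u, Complex.I • v] = γ ![u, v])
    (hpos : ∀ u, 0 ≤ γ ![u, Complex.I • u]) :
    ∃ g : Cn p →ₗ[ℂ] Cn p, ∀ u v, γ ![u, v] = (inner ℂ (g u) (g v)).im := by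
  let T : Cn p →ₗ[ℂ] Cn p :=
    { toFun v := WithLp.toLp 2 fun j => hermForm γ (EuclideanSpace.single j 1) v
      map_add' v w := by ext j; simp [hermForm_add_right]
      map_smul' c v := by ext j; simp [hermForm_smul_right] }
  have hT : ∀ u v, inner ℂ u (T v) = hermForm γ u v := by
    intro u v
    let h : Cn p →ₗ⋆[ℂ] ℂ :=
      { toFun u := hermForm γ u v
        map_add' u w := by
          rw [hermForm_conj hinv, hermForm_add_right, star_add, ← hermForm_conj hinv,
            ← hermForm_conj hinv]
        map_smul' c u := by
          rw [hermForm_conj hinv, hermForm_smul_right, star_mul', ← hermForm_conj hinv]; rfl }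
    have hu : u = ∑ j, u j • EuclideanSpace.single j (1 : ℂ) := by
      ext k; simp [Finset.sum_apply, Pi.single_apply]
    change _ = h u
    conv_rhs => rw [hu, map_sum]
    simp only [map_smulₛₗ, PiLp.inner_apply]
    refine Finset.sum_congr rfl fun j _ => ?_
    simp [T, h, mul_comm]
  have hTpos : (LinearMap.toContinuousLinearMap T).IsPositive := by
    rw [ContinuousLinearMap.isPositive_iff_complex]
    intro x
    have h0 : hermForm γ x x = ((metricForm γ x x : ℝ) : ℂ) := by
      apply Complex.ext
      · rfl
      · have := form_swap γ x x
        simp only [hermForm, Complex.ofReal_im]; linarith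
    have : inner ℂ ((LinearMap.toContinuousLinearMap T) x) x = ((metricForm γ x x : ℝ) : ℂ) := by
      rw [← inner_conj_symm]
      simp [hT, h0]
    rw [this]
    refine ⟨by simp, ?_⟩
    simpa [metricForm_apply] using hpos x
  obtain ⟨S, hS⟩ := CStarAlgebra.nonneg_iff_eq_star_mul_self.1
    ((ContinuousLinearMap.nonneg_iff_isPositive _).2 hTpos)
  refine ⟨S.toLinearMap, fun u v => ?_⟩
  have h1 : T v = (star S * S) v := by rw [← hS]; rfl
  have h2 := hT u v
  rw [h1, ContinuousLinearMap.star_eq_adjoint, mul_apply_eq_comp,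
    ContinuousLinearMap.adjoint_inner_right] at h2
  exact (congrArg Complex.im h2).symm

/-- The seminorm of the metric of `γ`. -/
noncomputable def formNorm {p : ℕ} (γ : Cn p [⋀^Fin 2]→L[ℝ] ℝ) (v : Cn p) : ℝ :=
  √(γ ![v, Complex.I • v])

section Factorization

variable {p : ℕ} {γ : Cn p [⋀^Fin 2]→L[ℝ] ℝ} {g : Cn p →ₗ[ℂ] Cn p}

theorem metricForm_eq_inner (hg : ∀ u v, γ ![u, v] = (inner ℂ (g u) (g v)).im) (u v : Cn p) :
    metricForm γ u v = inner ℝ (g u) (g v) := by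
  rw [metricForm_apply, hg, map_smul, inner_smul_right, inner_real_eq_re]; simp

theorem formNorm_eq_norm (hg : ∀ u v, γ ![u, v] = (inner ℂ (g u) (g v)).im) (v : Cn p) :
    formNorm γ v = ‖g v‖ := by
  rw [formNorm, ← metricForm_apply, metricForm_eq_inner hg, real_inner_self_eq_norm_sq,
    Real.sqrt_sq (norm_nonneg _)]

theorem abs_form_le (hg : ∀ u v, γ ![u, v] = (inner ℂ (g u) (g v)).im) (u v : Cn p) :
    |γ ![u, v]| ≤ formNorm γ u * formNorm γ v := by
  rw [hg, formNorm_eq_norm hg, formNorm_eq_norm hg]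
  exact (Complex.abs_im_le_norm _).trans (norm_inner_le_norm _ _)

end Factorization

/-- A real alternating form of top degree transforms under a complex linear map by the square of
the modulus of its determinant. -/
theorem topForm_comp {p : ℕ} (Z : Cn p [⋀^Fin (2 * p)]→L[ℝ] ℝ) (g : Cn p →ₗ[ℂ] Cn p)
    (v : Fin (2 * p) → Cn p) :
    Z (fun i => g (v i)) = ‖LinearMap.det g‖ ^ 2 * Z v := by
  have h := AlternatingMap.eq_smul_basis_det (stdBasis p).toBasis Z.toAlternatingMap
  have hZ : ∀ w, Z w = Z.toAlternatingMap (stdBasis p).toBasis * (stdBasis p).toBasis.det w :=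
    fun w => DFunLike.congr_fun h w
  have hd := Module.Basis.det_comp (stdBasis p).toBasis (g.restrictScalars ℝ) v
  rw [hZ, hZ v]
  have hd' : (stdBasis p).toBasis.det (fun i => g (v i)) =
      ‖LinearMap.det g‖ ^ 2 * (stdBasis p).toBasis.det v := by
    refine hd.trans ?_
    congr 1
    rw [LinearMap.det_restrictScalars, Algebra.norm_complex_eq, ← Complex.normSq_eq_norm_sq]
    rfl
  rw [hd']; ring

/-- The standard Kähler form of `ℂᵖ`. -/
noncomputable def stdForm (p : ℕ) : Cn p [⋀^Fin 2]→L[ℝ] ℝ where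
  toFun v := (inner ℂ (v 0) (v 1)).im
  map_update_add' := by
    intro _ v i x y
    fin_cases i <;> simp
  map_update_smul' := by
    intro _ v i c x
    fin_cases i <;> simp [inner_smul_left_eq_star_smul, inner_smul_right_eq_smul]
  cont := Complex.continuous_im.comp ((continuous_apply 0).inner (continuous_apply 1))
  map_eq_zero_of_eq' := by
    intro v i j hij hne
    have h : v 0 = v 1 := by
      fin_cases i <;> fin_cases j <;> simp_all
    have := inner_self_im (𝕜 := ℂ) (v 1)
    rw [h]
    exact this

theorem stdForm_apply {p : ℕ} (u v : Cn p) : stdForm p ![u, v] = (inner ℂ u v).im := rfl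

theorem dividedPower_stdFrame {p : ℕ} {γ : Cn p [⋀^Fin 2]→L[ℝ] ℝ} {g : Cn p →ₗ[ℂ] Cn p}
    (hg : ∀ u v, γ ![u, v] = (inner ℂ (g u) (g v)).im) :
    dividedPower p γ (fun k => stdFrame p k) = ‖LinearMap.det g‖ ^ 2 * stdVolume p := by
  have h1 : dividedPower p γ (fun k => stdFrame p k) =
      dividedPower p (stdForm p) (fun k => g (stdFrame p k)) := by
    simp only [dividedPower_apply, hg, stdForm_apply]
  have h2 : dividedPower p (stdForm p) (fun k => stdFrame p k) = stdVolume p := by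
    simp only [dividedPower_apply, stdForm_apply, stdVolume]
  rw [h1, topForm_comp, h2]

theorem topForm_update_stdFrame {p : ℕ} (Z : Cn p [⋀^Fin (2 * p)]→L[ℝ] ℝ) (k : Fin (2 * p))
    (a : Cn p) :
    Z (Function.update (fun k : Fin (2 * p) => stdFrame p k) k a) =
      inner ℝ (stdFrame p k) a * Z (fun k => stdFrame p k) := by
  have h := Z.toAlternatingMap.map_update_sum Finset.univ k
    (fun i => (stdBasis p).repr a i • stdBasis p i) (fun k : Fin (2 * p) => stdFrame p k)
  rw [(stdBasis p).sum_repr a, Finset.sum_eq_single k] at h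
  · refine h.trans ?_
    rw [AlternatingMap.map_update_smul, stdBasis_apply, Function.update_eq_self,
      (stdBasis p).repr_apply_apply, stdBasis_apply]
    rfl
  · intro j _ hj
    rw [AlternatingMap.map_update_smul, stdBasis_apply,
      Z.toAlternatingMap.map_eq_zero_of_eq _ (i := k) (j := j) (by simp [hj]) hj.symm, smul_zero]
  · simp

/-- A form of top degree vanishes if its contraction with some nonzero vector does. -/
theorem topForm_eq_zero {p : ℕ} (Z : Cn p [⋀^Fin (2 * p)]→L[ℝ] ℝ) {a : Cn p} (ha : a ≠ 0)
    (hZ : ∀ v i, v i = a → Z v = 0) : Z (fun k => stdFrame p k) = 0 := by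
  obtain ⟨k, hk⟩ : ∃ k, (stdBasis p).repr a k ≠ 0 := by
    by_contra! h
    exact ha ((stdBasis p).repr.map_eq_zero_iff.1 (by ext k; exact h k))
  have h0 := hZ (Function.update (fun k : Fin (2 * p) => stdFrame p k) k a) k (by simp)
  rw [topForm_update_stdFrame] at h0
  rw [(stdBasis p).repr_apply_apply, stdBasis_apply] at hk
  exact (mul_eq_zero.1 h0).resolve_left hk

/-- Comparison of forms of top degree: a form `Z` of top degree that is bounded by `K` for the
metric of `γ` is at most a multiple of the volume form of `γ`. -/
theorem abs_topForm_le {p : ℕ} {γ : Cn p [⋀^Fin 2]→L[ℝ] ℝ}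
    (hinv : ∀ u v, γ ![Complex.I • u, Complex.I • v] = γ ![u, v])
    (hpos : ∀ u, 0 ≤ γ ![u, Complex.I • u]) (Z : Cn p [⋀^Fin (2 * p)]→L[ℝ] ℝ) {K : ℝ}
    (hZ : ∀ v, |Z v| ≤ K * ∏ i, formNorm γ (v i)) :
    |Z (fun k => stdFrame p k)| ≤ K / stdVolume p * dividedPower p γ (fun k => stdFrame p k) := by
  obtain ⟨g, hg⟩ := exists_eq_im_inner γ hinv hpos
  rw [dividedPower_stdFrame hg]
  by_cases hdet : LinearMap.det g = 0
  · obtain ⟨a, ha, hga⟩ : ∃ a, a ≠ 0 ∧ g a = 0 := by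
      have := LinearMap.bot_lt_ker_of_det_eq_zero hdet
      obtain ⟨a, ha, h⟩ := (Submodule.ne_bot_iff _).1 this.ne'
      exact ⟨a, h, ha⟩
    rw [topForm_eq_zero Z ha, hdet]
    · simp
    · intro v i hi
      have := hZ v
      rw [Finset.prod_eq_zero (Finset.mem_univ i)] at this
      · simpa using this
      · rw [hi, formNorm_eq_norm hg, hga, norm_zero]
  · let e := LinearMap.equivOfDetNeZero g hdet
    have he : ∀ v, g (e.symm v) = v := fun v => e.apply_symm_apply v
    have h1 : Z (fun k => stdFrame p k) =
        ‖LinearMap.det g‖ ^ 2 * Z (fun k => e.symm (stdFrame p k)) := by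
      rw [← topForm_comp]; simp only [he]
    have h2 := hZ (fun k => e.symm (stdFrame p k))
    simp only [formNorm_eq_norm hg, he, norm_stdFrame, Finset.prod_const_one, mul_one] at h2
    rw [h1, abs_mul, abs_of_nonneg (by positivity)]
    have := stdVolume_pos p
    calc _ ≤ ‖LinearMap.det g‖ ^ 2 * K := by gcongr
      _ = _ := by field_simp

/-! ### The wedge product with a covector -/

/-- The integrand of `sphereIntegral`: the value of `ν ∧ ζ` on the standard frame, where `ν` is the
covector `⟨w, ·⟩`. -/
noncomputable def fluxDensity {p d : ℕ} (w : Cn p) (ζ : Cn p [⋀^Fin d]→L[ℝ] ℝ) : ℝ :=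
  ∑ j ∈ Finset.range (2 * p), (-1) ^ j * inner ℝ (stdFrame p j) w *
    ζ (fun l => stdFrame p (if (l : ℕ) < j then l else l + 1))

/-- The wedge product `ν ∧ ζ` of a covector and a form of degree `2p - 1`. -/
noncomputable def wedge {p d : ℕ} (h : d + 1 = 2 * p) (ν : Cn p →L[ℝ] ℝ)
    (ζ : Cn p [⋀^Fin d]→L[ℝ] ℝ) : Cn p [⋀^Fin (2 * p)]→L[ℝ] ℝ :=
  { (ContinuousAlternatingMap.alternatizeUncurryFin
      (ν.smulRight ζ)).toContinuousMultilinearMap.domDomCongr (finCongr h) with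
    map_eq_zero_of_eq' := fun v i j hv hij =>
      (ContinuousAlternatingMap.alternatizeUncurryFin (ν.smulRight ζ)).map_eq_zero_of_eq
        (fun l => v (finCongr h l)) (i := (finCongr h).symm i) (j := (finCongr h).symm j)
        (by simpa using hv) (by simpa using hij) }

theorem wedge_apply {p d : ℕ} (h : d + 1 = 2 * p) (ν : Cn p →L[ℝ] ℝ)
    (ζ : Cn p [⋀^Fin d]→L[ℝ] ℝ) (v : Fin (2 * p) → Cn p) :
    wedge h ν ζ v = ∑ i : Fin (d + 1), (-1) ^ (i : ℕ) * (ν (v (Fin.cast h i)) *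
      ζ (i.removeNth fun l => v (Fin.cast h l))) := by
  refine (ContinuousAlternatingMap.alternatizeUncurryFin_apply (ν.smulRight ζ)
    (fun l => v (Fin.cast h l))).trans (Finset.sum_congr rfl fun i _ => ?_)
  rw [zsmul_eq_mul]
  push_cast
  rfl

theorem fluxDensity_eq_sum {p d : ℕ} (h : d + 1 = 2 * p) (w : Cn p)
    (ζ : Cn p [⋀^Fin d]→L[ℝ] ℝ) :
    fluxDensity w ζ = ∑ i : Fin (d + 1), (-1) ^ (i : ℕ) * (inner ℝ w (stdFrame p i) *
      ζ (i.removeNth fun l : Fin (d + 1) => stdFrame p l)) := by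
  rw [fluxDensity, ← h, Finset.sum_range]
  refine Finset.sum_congr rfl fun i _ => ?_
  rw [mul_assoc, real_inner_comm]
  congr 4
  funext l
  simp only [Fin.removeNth, Fin.succAbove, Fin.lt_def, Fin.val_castSucc]
  split_ifs <;> simp

theorem fluxDensity_eq_wedge {p d : ℕ} (h : d + 1 = 2 * p) (w : Cn p)
    (ζ : Cn p [⋀^Fin d]→L[ℝ] ℝ) :
    fluxDensity w ζ = wedge h (innerSL ℝ w) ζ (fun k => stdFrame p k) := by
  rw [fluxDensity_eq_sum h, wedge_apply]
  rfl

/-- For a form `Z` of top degree, `ν ∧ ι_s Z = ν(s) Z`. -/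
theorem fluxDensity_interior {p : ℕ} (hp : 1 ≤ p) (w s : Cn p)
    (Z : Cn p [⋀^Fin (2 * p)]→L[ℝ] ℝ) :
    fluxDensity w (interior s Z) = inner ℝ w s * Z (fun k => stdFrame p k) := by
  obtain ⟨q, rfl⟩ : ∃ q, p = q + 1 := ⟨p - 1, by omega⟩
  rw [fluxDensity_eq_sum (d := 2 * q + 1) rfl]
  have h : ∀ i : Fin (2 * q + 1 + 1), (-1 : ℝ) ^ (i : ℕ) *
      (inner ℝ w (stdFrame (q + 1) i) *
        (interior s Z : Cn (q + 1) [⋀^Fin (2 * q + 1)]→L[ℝ] ℝ)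
          (i.removeNth fun l : Fin (2 * q + 1 + 1) => stdFrame (q + 1) l)) =
      inner ℝ (stdFrame (q + 1) i) s * inner ℝ (stdFrame (q + 1) i) w *
        Z (fun k => stdFrame (q + 1) k) := by
    intro i
    have h1 := AlternatingMap.neg_one_pow_smul_map_insertNth
      (ContinuousAlternatingMap.toAlternatingMap Z : Cn (q + 1) [⋀^Fin (2 * q + 1 + 1)]→ₗ[ℝ] ℝ) i s
      (i.removeNth fun l : Fin (2 * q + 1 + 1) => stdFrame (q + 1) l)
    rw [Fin.insertNth_removeNth] at h1
    have h2 := topForm_update_stdFrame Z i s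
    have h3 : (interior s Z : Cn (q + 1) [⋀^Fin (2 * q + 1)]→L[ℝ] ℝ)
        (i.removeNth fun l : Fin (2 * q + 1 + 1) => stdFrame (q + 1) l) =
        (-1 : ℝ) ^ (i : ℕ) * (inner ℝ (stdFrame (q + 1) i) s * Z (fun k => stdFrame (q + 1) k)) := by
      rw [← h2]
      refine h1.symm.trans ?_
      rw [zsmul_eq_mul]; push_cast; rfl
    rw [h3, real_inner_comm (stdFrame (q + 1) i) w]
    have : (-1 : ℝ) ^ (i : ℕ) * (-1 : ℝ) ^ (i : ℕ) = 1 := by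
      rw [← mul_pow]; simp
    linear_combination (inner ℝ (stdFrame (q + 1) i) w * inner ℝ (stdFrame (q + 1) i) s *
      Z (fun k => stdFrame (q + 1) k)) * this
  rw [Finset.sum_congr rfl fun i _ => h i, ← Finset.sum_mul]
  congr 1
  have := (stdBasis (q + 1)).sum_inner_mul_inner w s
  rw [← this]
  refine Finset.sum_congr rfl fun i _ => ?_
  rw [stdBasis_apply, mul_comm, real_inner_comm w]

theorem abs_wedge_le {p d : ℕ} (h : d + 1 = 2 * p) {ν : Cn p →L[ℝ] ℝ}
    {ζ : Cn p [⋀^Fin d]→L[ℝ] ℝ} {N : Cn p → ℝ} {A C : ℝ} (hν : ∀ v, |ν v| ≤ A * N v)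
    (hζ : ∀ v, |ζ v| ≤ C * ∏ i, N (v i)) (v : Fin (2 * p) → Cn p) :
    |wedge h ν ζ v| ≤ 2 * p * (A * C) * ∏ i, N (v i) := by
  rw [wedge_apply]
  have hprod : ∏ i, N (v i) = ∏ i : Fin (d + 1), N (v (Fin.cast h i)) :=
    (Fintype.prod_equiv (finCongr h) _ _ fun _ => rfl).symm
  have hterm : ∀ i : Fin (d + 1), |(-1) ^ (i : ℕ) * (ν (v (Fin.cast h i)) *
      ζ (i.removeNth fun l => v (Fin.cast h l)))| ≤ A * C * ∏ i, N (v i) := by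
    intro i
    rw [abs_mul, abs_pow, abs_neg, abs_one, one_pow, one_mul, abs_mul, hprod,
      Fin.prod_univ_succAbove _ i]
    calc _ ≤ (A * N (v (Fin.cast h i))) *
          (C * ∏ l, N (i.removeNth (fun l => v (Fin.cast h l)) l)) :=
          mul_le_mul (hν _) (hζ _) (abs_nonneg _) ((abs_nonneg _).trans (hν _))
      _ = _ := by simp only [Fin.removeNth]; ring
  refine (Finset.abs_sum_le_sum_abs _ _).trans ((Finset.sum_le_sum fun i _ => hterm i).trans ?_)
  rw [Finset.sum_const, Finset.card_univ, Fintype.card_fin, h, nsmul_eq_mul]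
  push_cast
  exact (mul_assoc _ _ _).ge

/-! ### The density of the area form -/

/-- The density of the area form of the metric of `γ` on a hyperplane with Euclidean conormal
`⟨w, ·⟩`: the norm of the conormal for `γ` times the density of the volume form. -/
noncomputable def areaDensity {p : ℕ} (γ : Cn p [⋀^Fin 2]→L[ℝ] ℝ) (w : Cn p) : ℝ :=
  √(inner ℝ w (sharp γ (innerSL ℝ w))) * dividedPower p γ (fun k => stdFrame p k)

theorem sharp_smul {p : ℕ} (γ : Cn p [⋀^Fin 2]→L[ℝ] ℝ) (c : ℝ) (θ : Cn p →L[ℝ] ℝ) :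
    sharp γ (c • θ) = c • sharp γ θ := by
  unfold sharp
  split_ifs
  · rw [ContinuousLinearMap.toLinearMap_smul, map_smul]
  · simp

theorem metricForm_sharp {p : ℕ} {γ : Cn p [⋀^Fin 2]→L[ℝ] ℝ} (h : (metricForm γ).Nondegenerate)
    (θ : Cn p →L[ℝ] ℝ) (v : Cn p) : metricForm γ (sharp γ θ) v = θ v := by
  rw [sharp, dif_pos h]
  exact LinearMap.BilinForm.apply_toDual_symm_apply _ _

/-- The integrand of the area is `areaDensity`. The junk values of `covectorNorm` and `sharp` agree
with this at degenerate points, where both sides are zero. -/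
theorem fluxDensity_hodgeStar {p : ℕ} (hp : 1 ≤ p) (γ : Cn p [⋀^Fin 2]→L[ℝ] ℝ) (w : Cn p) {r : ℝ}
    (hr : 0 < r) {dτ : Cn p →L[ℝ] ℝ} (hτ : dτ = r • innerSL ℝ w) :
    fluxDensity w (hodgeStar γ ((covectorNorm γ dτ)⁻¹ • dτ)) = areaDensity γ w := by
  have hs : ∀ a : Cn p, innerSL ℝ w a = inner ℝ w a := fun _ => rfl
  rw [hodgeStar, fluxDensity_interior hp, areaDensity]
  congr 1
  rw [hτ, covectorNorm, sharp_smul, sharp_smul, smul_apply, map_smul,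
    inner_smul_right, inner_smul_right, hs, smul_eq_mul, smul_eq_mul]
  set a := inner ℝ w (sharp γ (innerSL ℝ w))
  rw [← mul_assoc r r a, Real.sqrt_mul (by positivity), Real.sqrt_mul_self hr.le]
  rcases le_or_gt a 0 with ha | ha
  · simp [Real.sqrt_eq_zero_of_nonpos ha]
  · have := Real.sqrt_pos.2 ha
    field_simp
    exact (Real.sq_sqrt ha.le).symm

section Factorization

variable {p : ℕ} {γ : Cn p [⋀^Fin 2]→L[ℝ] ℝ} {g : Cn p →ₗ[ℂ] Cn p}

theorem nondegenerate_of_det_ne_zero (hg : ∀ u v, γ ![u, v] = (inner ℂ (g u) (g v)).im)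
    (hdet : LinearMap.det g ≠ 0) : (metricForm γ).Nondegenerate := by
  apply LinearMap.BilinForm.Nondegenerate.ofSeparatingLeft
  intro u hu
  have h := hu u
  rw [metricForm_eq_inner hg, real_inner_self_eq_norm_sq, sq_eq_zero_iff, norm_eq_zero] at h
  exact (LinearMap.equivOfDetNeZero g hdet).map_eq_zero_iff.1 h

/-- Cauchy-Schwarz inequality between a covector and a vector, for the metric of `γ`. -/
theorem abs_inner_le_sharp (hg : ∀ u v, γ ![u, v] = (inner ℂ (g u) (g v)).im)
    (hdet : LinearMap.det g ≠ 0) (w v : Cn p) :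
    |inner ℝ w v| ≤ √(inner ℝ w (sharp γ (innerSL ℝ w))) * formNorm γ v := by
  have h := metricForm_sharp (nondegenerate_of_det_ne_zero hg hdet) (innerSL ℝ w)
  simp only [metricForm_eq_inner hg, innerSL_apply_apply] at h
  rw [← h, ← h, real_inner_self_eq_norm_sq, Real.sqrt_sq (norm_nonneg _), formNorm_eq_norm hg]
  exact abs_real_inner_le_norm _ _

theorem formNorm_sharp (hg : ∀ u v, γ ![u, v] = (inner ℂ (g u) (g v)).im)
    (hdet : LinearMap.det g ≠ 0) (w : Cn p) :
    formNorm γ (sharp γ (innerSL ℝ w)) = √(inner ℝ w (sharp γ (innerSL ℝ w))) := by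
  have h := metricForm_sharp (nondegenerate_of_det_ne_zero hg hdet) (innerSL ℝ w)
  rw [formNorm, ← metricForm_apply, h, innerSL_apply_apply]

end Factorization

theorem dividedPower_stdFrame_nonneg {p : ℕ} {γ : Cn p [⋀^Fin 2]→L[ℝ] ℝ}
    (hinv : ∀ u v, γ ![Complex.I • u, Complex.I • v] = γ ![u, v])
    (hpos : ∀ u, 0 ≤ γ ![u, Complex.I • u]) : 0 ≤ dividedPower p γ (fun k => stdFrame p k) := by
  obtain ⟨g, hg⟩ := exists_eq_im_inner γ hinv hpos
  rw [dividedPower_stdFrame hg]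
  have := stdVolume_pos p
  positivity

theorem dividedPower_stdFrame_pos {p : ℕ} {γ : Cn p [⋀^Fin 2]→L[ℝ] ℝ}
    (hinv : ∀ u v, γ ![Complex.I • u, Complex.I • v] = γ ![u, v])
    (hpos : ∀ u, u ≠ 0 → 0 < γ ![u, Complex.I • u]) :
    0 < dividedPower p γ (fun k => stdFrame p k) := by
  have hpos' : ∀ u, 0 ≤ γ ![u, Complex.I • u] := by
    intro u
    by_cases hu : u = 0
    · rw [hu, smul_zero]
      exact (γ.map_coord_zero (m := ![(0 : Cn p), 0]) 0 rfl).ge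
    · exact (hpos u hu).le
  obtain ⟨g, hg⟩ := exists_eq_im_inner γ hinv hpos'
  rw [dividedPower_stdFrame hg]
  have := stdVolume_pos p
  have hdet : LinearMap.det g ≠ 0 := by
    intro hdet
    obtain ⟨a, ha, h⟩ := (Submodule.ne_bot_iff _).1 (LinearMap.bot_lt_ker_of_det_eq_zero hdet).ne'
    have := hpos a h
    rw [hg, LinearMap.mem_ker.1 ha] at this
    simp at this
  positivity

/-- A form of degree `2p - 1` that is bounded for the metric of `γ` has a flux through a hyperplane
bounded by the area form. -/
theorem abs_fluxDensity_le {p d : ℕ} (h : d + 1 = 2 * p) {γ : Cn p [⋀^Fin 2]→L[ℝ] ℝ}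
    (hinv : ∀ u v, γ ![Complex.I • u, Complex.I • v] = γ ![u, v])
    (hpos : ∀ u, 0 ≤ γ ![u, Complex.I • u]) {ζ : Cn p [⋀^Fin d]→L[ℝ] ℝ} {C : ℝ}
    (hζ : ∀ v, |ζ v| ≤ C * ∏ i, formNorm γ (v i)) (w : Cn p) :
    |fluxDensity w ζ| ≤ 2 * p * C / stdVolume p * areaDensity γ w := by
  obtain ⟨g, hg⟩ := exists_eq_im_inner γ hinv hpos
  rw [fluxDensity_eq_wedge h]
  by_cases hdet : LinearMap.det g = 0
  · obtain ⟨a, ha, hne⟩ := (Submodule.ne_bot_iff _).1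
      (LinearMap.bot_lt_ker_of_det_eq_zero hdet).ne'
    -- Some nonzero complex multiple of the null vector `a` is also annihilated by the covector.
    obtain ⟨b, hb, hgb, hwb⟩ : ∃ b, b ≠ 0 ∧ g b = 0 ∧ inner ℝ w b = 0 := by
      by_cases h0 : inner ℂ w a = 0
      · exact ⟨a, hne, ha, by rw [inner_real_eq_re, h0]; rfl⟩
      · refine ⟨(Complex.I * star (inner ℂ w a)) • a, ?_, ?_, ?_⟩
        · exact smul_ne_zero (mul_ne_zero Complex.I_ne_zero (star_ne_zero.2 h0)) hne
        · rw [map_smul, LinearMap.mem_ker.1 ha, smul_zero]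
        · rw [inner_real_eq_re, inner_smul_right, mul_assoc, mul_comm (star _)]
          have := Complex.mul_conj (inner ℂ w a)
          change (Complex.I * (inner ℂ w a * (starRingEnd ℂ) (inner ℂ w a))).re = 0
          rw [this]; simp
    have hZ : wedge h (innerSL ℝ w) ζ (fun k => stdFrame p k) = 0 := by
      refine topForm_eq_zero _ hb fun v i hi => ?_
      rw [wedge_apply]
      refine Finset.sum_eq_zero fun j _ => ?_
      by_cases hj : Fin.cast h j = i
      · rw [hj, hi, innerSL_apply_apply, hwb]; simp
      · obtain ⟨l, hl⟩ := Fin.exists_succAbove_eq (x := Fin.cast h.symm i) (y := j)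
          (fun hh => hj (by rw [hh.symm]; rfl))
        have : ζ (j.removeNth fun l => v (Fin.cast h l)) = 0 := by
          have := hζ (j.removeNth fun l => v (Fin.cast h l))
          rw [Finset.prod_eq_zero (Finset.mem_univ l)] at this
          · simpa using this
          · rw [Fin.removeNth, hl, formNorm_eq_norm hg]
            change ‖g (v i)‖ = 0
            rw [hi, hgb, norm_zero]
        rw [this]; simp
    have hz : areaDensity γ w = 0 := by
      rw [areaDensity, dividedPower_stdFrame hg, hdet]; simp
    rw [hZ, hz]; simp
  · have := abs_topForm_le hinv hpos (wedge h (innerSL ℝ w) ζ)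
      (abs_wedge_le h (fun v => abs_inner_le_sharp hg hdet w v) hζ)
    refine this.trans (le_of_eq ?_)
    rw [areaDensity]; ring

theorem abs_dividedPower_le {p m : ℕ} {γ : Cn p [⋀^Fin 2]→L[ℝ] ℝ}
    (hinv : ∀ u v, γ ![Complex.I • u, Complex.I • v] = γ ![u, v])
    (hpos : ∀ u, 0 ≤ γ ![u, Complex.I • u]) (v : Fin (2 * m) → Cn p) :
    |dividedPower m γ v| ≤ (2 * m).factorial * ∏ i, formNorm γ (v i) := by
  obtain ⟨g, hg⟩ := exists_eq_im_inner γ hinv hpos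
  have hterm : ∀ σ : Equiv.Perm (Fin (2 * m)), |((Equiv.Perm.sign σ : ℤ) : ℝ) *
        ∏ i : Fin m, γ ![v (σ ⟨2 * i, by omega⟩), v (σ ⟨2 * i + 1, by omega⟩)]| ≤
      ∏ i, formNorm γ (v i) := by
    intro σ
    have h1 : |((Equiv.Perm.sign σ : ℤ) : ℝ)| = 1 := by
      rcases Int.units_eq_one_or (Equiv.Perm.sign σ) with h | h <;> simp [h]
    rw [abs_mul, h1, one_mul, Finset.abs_prod]
    calc _ ≤ ∏ i : Fin m, ∏ b : Fin 2, formNorm γ (v (σ (frameEquiv m (i, b)))) := by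
          refine Finset.prod_le_prod (fun _ _ => abs_nonneg _) fun i _ => ?_
          have e0 : frameEquiv m (i, 0) = ⟨2 * i, by omega⟩ := Fin.ext (by simp [frameEquiv_val])
          have e1 : frameEquiv m (i, 1) = ⟨2 * i + 1, by omega⟩ :=
            Fin.ext (by simp [frameEquiv_val])
          rw [Fin.prod_univ_two, e0, e1]
          exact abs_form_le hg _ _
      _ = _ := by
          rw [← Fintype.prod_prod_type']
          exact Fintype.prod_equiv ((frameEquiv m).trans σ) _ _ fun _ => rfl
  rw [dividedPower_apply, abs_mul]
  have h2 : |((2 ^ m * m.factorial : ℝ)⁻¹)| ≤ 1 := by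
    rw [abs_of_nonneg (by positivity)]
    apply inv_le_one_of_one_le₀
    have : (1 : ℝ) ≤ m.factorial := by exact_mod_cast Nat.one_le_iff_ne_zero.2 m.factorial_ne_zero
    exact one_le_mul_of_one_le_of_one_le (one_le_pow₀ (by norm_num)) this
  calc _ ≤ 1 * ∑ σ : Equiv.Perm (Fin (2 * m)), ∏ i, formNorm γ (v i) := by
        gcongr
        exact (Finset.abs_sum_le_sum_abs _ _).trans (Finset.sum_le_sum fun σ _ => hterm σ)
    _ = _ := by
        rw [one_mul, Finset.sum_const, Finset.card_univ, Fintype.card_perm, Fintype.card_fin,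
          nsmul_eq_mul]

/-- Monotonicity of volume forms, up to a constant. -/
theorem dividedPower_stdFrame_le {p : ℕ} {γ γ' : Cn p [⋀^Fin 2]→L[ℝ] ℝ}
    (hinv : ∀ u v, γ ![Complex.I • u, Complex.I • v] = γ ![u, v])
    (hpos : ∀ u, 0 ≤ γ ![u, Complex.I • u])
    (hinv' : ∀ u v, γ' ![Complex.I • u, Complex.I • v] = γ' ![u, v])
    (hpos' : ∀ u, 0 ≤ γ' ![u, Complex.I • u]) {C : ℝ}
    (hC : ∀ v, formNorm γ v ≤ C * formNorm γ' v) :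
    dividedPower p γ (fun k => stdFrame p k) ≤
      (2 * p).factorial * C ^ (2 * p) / stdVolume p *
        dividedPower p γ' (fun k => stdFrame p k) := by
  refine (le_abs_self _).trans (abs_topForm_le hinv' hpos' (dividedPower p γ) fun v => ?_)
  refine (abs_dividedPower_le hinv hpos v).trans ?_
  rw [mul_assoc]
  gcongr
  calc _ ≤ ∏ i, (C * formNorm γ' (v i)) :=
        Finset.prod_le_prod (fun _ _ => Real.sqrt_nonneg _) fun i _ => hC _
    _ = _ := by rw [Finset.prod_mul_distrib]; simp

theorem areaDensity_nonneg {p : ℕ} {γ : Cn p [⋀^Fin 2]→L[ℝ] ℝ}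
    (hinv : ∀ u v, γ ![Complex.I • u, Complex.I • v] = γ ![u, v])
    (hpos : ∀ u, 0 ≤ γ ![u, Complex.I • u]) (w : Cn p) : 0 ≤ areaDensity γ w :=
  mul_nonneg (Real.sqrt_nonneg _) (dividedPower_stdFrame_nonneg hinv hpos)

/-- The area density is bounded in terms of the form `γ`, uniformly near degenerate forms: with `s`
dual to the conormal `ν`, one has `ν(s) γ_p = ν ∧ ι_s γ_p`, which is bounded by a multiple of the norm
`√ν(s)` of `s`. -/
theorem areaDensity_le {p : ℕ} (hp : 1 ≤ p) {γ : Cn p [⋀^Fin 2]→L[ℝ] ℝ}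
    (hinv : ∀ u v, γ ![Complex.I • u, Complex.I • v] = γ ![u, v])
    (hpos : ∀ u, 0 ≤ γ ![u, Complex.I • u]) {B : ℝ}
    (hB : ∀ k : Fin (2 * p), formNorm γ (stdFrame p k) ≤ B) (w : Cn p) :
    areaDensity γ w ≤ 2 * p * ((2 * p).factorial * ‖w‖ * B ^ (2 * p - 1)) := by
  obtain ⟨q, rfl⟩ : ∃ q, p = q + 1 := ⟨p - 1, by omega⟩
  obtain ⟨g, hg⟩ := exists_eq_im_inner γ hinv hpos
  have hB0 : 0 ≤ B := (Real.sqrt_nonneg _).trans (hB ⟨0, by omega⟩)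
  by_cases hdet : LinearMap.det g = 0
  · rw [areaDensity, dividedPower_stdFrame hg, hdet]
    simp only [norm_zero, zero_pow two_ne_zero, zero_mul, mul_zero]
    positivity
  set s := sharp γ (innerSL ℝ w) with hs
  have h1 := fluxDensity_interior hp w s (dividedPower (q + 1) γ)
  have hss := formNorm_sharp hg hdet w
  rw [← hs] at hss
  set a := √(inner ℝ w s) with ha
  have ha0 : 0 ≤ a := Real.sqrt_nonneg _
  have hws : inner ℝ w s = a * a := by
    refine (Real.mul_self_sqrt ?_).symm
    have := metricForm_sharp (nondegenerate_of_det_ne_zero hg hdet) (innerSL ℝ w) s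
    rw [innerSL_apply_apply] at this
    rw [← this]; exact hpos _
  have h2 : fluxDensity w (interior s (dividedPower (q + 1) γ)) ≤
      a * ((2 * (q + 1) : ℕ) * ((2 * (q + 1)).factorial * ‖w‖ * B ^ (2 * q + 1))) := by
    rw [fluxDensity_eq_sum (d := 2 * q + 1) rfl]
    have hterm : ∀ i : Fin (2 * q + 1 + 1), (-1 : ℝ) ^ (i : ℕ) *
      (inner ℝ w (stdFrame (q + 1) i) *
        (interior s (dividedPower (q + 1) γ) : Cn (q + 1) [⋀^Fin (2 * q + 1)]→L[ℝ] ℝ)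
          (i.removeNth fun l : Fin (2 * q + 1 + 1) => stdFrame (q + 1) l)) ≤
        a * ((2 * (q + 1)).factorial * ‖w‖ * B ^ (2 * q + 1)) := by
      intro i
      refine (le_abs_self _).trans ?_
      rw [abs_mul, abs_pow, abs_neg, abs_one, one_pow, one_mul, abs_mul]
      have e1 : |inner ℝ w (stdFrame (q + 1) i)| ≤ ‖w‖ := by
        refine (abs_real_inner_le_norm _ _).trans ?_
        have := norm_stdFrame (p := q + 1) i
        rw [this, mul_one]
      have e2 : |(interior s (dividedPower (q + 1) γ) : Cn (q + 1) [⋀^Fin (2 * q + 1)]→L[ℝ] ℝ)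
          (i.removeNth fun l : Fin (2 * q + 1 + 1) => stdFrame (q + 1) l)| ≤
          (2 * (q + 1)).factorial * (a * B ^ (2 * q + 1)) := by
        refine (abs_dividedPower_le hinv hpos (m := q + 1) (Matrix.vecCons s
          (i.removeNth fun l : Fin (2 * q + 1 + 1) => stdFrame (q + 1) l))).trans ?_
        refine mul_le_mul_of_nonneg_left ?_ (by positivity)
        have := Fin.prod_univ_succ (fun j : Fin (2 * q + 1 + 1) => formNorm γ
          ((Matrix.vecCons s (i.removeNth fun l : Fin (2 * q + 1 + 1) => stdFrame (q + 1) l) :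
            Fin (2 * q + 1 + 1) → Cn (q + 1)) j))
        refine this.le.trans ?_
        simp only [Matrix.cons_val_zero, Matrix.cons_val_succ, hss]
        refine mul_le_mul_of_nonneg_left ?_ ha0
        refine (Finset.prod_le_prod (fun _ _ => Real.sqrt_nonneg _) fun j _ => hB _).trans ?_
        simp
      calc _ ≤ ‖w‖ * ((2 * (q + 1)).factorial * (a * B ^ (2 * q + 1))) := by gcongr
        _ = _ := by ring
    refine (Finset.sum_le_sum fun i _ => hterm i).trans (le_of_eq ?_)
    rw [Finset.sum_const, Finset.card_univ, Fintype.card_fin, nsmul_eq_mul]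
    push_cast; ring
  rw [h1, hws] at h2
  rw [areaDensity]
  rcases ha0.eq_or_lt with h0 | h0
  · rw [← hs, ← ha, ← h0, zero_mul]; positivity
  · have := le_of_mul_le_mul_left ((mul_assoc a a _).symm.trans_le h2) h0
    refine this.trans (le_of_eq ?_)
    push_cast; rfl

open Matrix in
/-- The vector dual to a covector in terms of the inverse Gram matrix. The formula also holds for a
degenerate metric, where both sides are zero. -/
theorem inner_sharp_eq {p : ℕ} (γ : Cn p [⋀^Fin 2]→L[ℝ] ℝ) (w : Cn p) :
    inner ℝ w (sharp γ (innerSL ℝ w)) =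
      ((fun i : Fin (2 * p) => inner ℝ w (stdFrame p i)) ᵥ*
        (Matrix.of fun i j : Fin (2 * p) => metricForm γ (stdFrame p i) (stdFrame p j))⁻¹) ⬝ᵥ
        fun i : Fin (2 * p) => inner ℝ w (stdFrame p i) := by
  have hG : (Matrix.of fun i j : Fin (2 * p) => metricForm γ (stdFrame p i) (stdFrame p j)) =
      LinearMap.BilinForm.toMatrix (stdBasis p).toBasis (metricForm γ) := by
    ext i j
    rw [LinearMap.BilinForm.toMatrix_apply, OrthonormalBasis.coe_toBasis, stdBasis_apply,
      stdBasis_apply]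
    rfl
  rw [hG]
  set G := LinearMap.BilinForm.toMatrix (stdBasis p).toBasis (metricForm γ)
  by_cases h : (metricForm γ).Nondegenerate
  · have hdet := (LinearMap.BilinForm.nondegenerate_iff_det_ne_zero (stdBasis p).toBasis).1 h
    set s := sharp γ (innerSL ℝ w) with hs
    have h1 : (fun i : Fin (2 * p) => inner ℝ (stdFrame p i) s) ᵥ* G =
        fun i : Fin (2 * p) => inner ℝ w (stdFrame p i) := by
      funext j
      have h2 := metricForm_sharp h (innerSL ℝ w) (stdFrame p j)
      rw [← hs, innerSL_apply_apply] at h2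
      have h3 := congrArg (fun t => metricForm γ t (stdFrame p j)) ((stdBasis p).sum_repr s)
      simp only [map_sum, LinearMap.sum_apply, map_smul, LinearMap.smul_apply, smul_eq_mul,
        (stdBasis p).repr_apply_apply, stdBasis_apply] at h3
      rw [← h2, ← h3, Matrix.vecMul, dotProduct]
      refine Finset.sum_congr rfl fun i _ => ?_
      rw [← hG]
      rfl
    rw [← h1, Matrix.vecMul_vecMul, Matrix.mul_nonsing_inv _ (isUnit_iff_ne_zero.2 hdet),
      Matrix.vecMul_one, h1, ← (stdBasis p).sum_inner_mul_inner]
    refine Finset.sum_congr rfl fun i _ => ?_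
    rw [stdBasis_apply, mul_comm]
  · have hdet : G.det = 0 := by
      by_contra hne
      exact h ((LinearMap.BilinForm.nondegenerate_iff_det_ne_zero (stdBasis p).toBasis).2 hne)
    rw [Matrix.nonsing_inv_apply_not_isUnit _ (by simp [hdet]), sharp, dif_neg h]
    simp

theorem continuous_dividedPower_apply {S : Type*} [TopologicalSpace S] {p m : ℕ}
    {γ : S → Cn p [⋀^Fin 2]→L[ℝ] ℝ} (hγ : ∀ v, Continuous fun s => γ s v)
    (v : Fin (2 * m) → Cn p) : Continuous fun s => dividedPower m (γ s) v := by
  simp only [dividedPower_apply]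
  exact continuous_const.mul (continuous_finsetSum _ fun σ _ => continuous_const.mul
    (continuous_finsetProd _ fun i _ => hγ _))

theorem measurable_areaDensity {S : Type*} [TopologicalSpace S] [MeasurableSpace S]
    [OpensMeasurableSpace S] {p : ℕ} {γ : S → Cn p [⋀^Fin 2]→L[ℝ] ℝ} {w : S → Cn p}
    (hγ : ∀ v, Continuous fun s => γ s v) (hw : Continuous w) :
    Measurable fun s => areaDensity (γ s) (w s) := by
  simp only [areaDensity, inner_sharp_eq]
  refine Measurable.mul (Measurable.sqrt ?_) (continuous_dividedPower_apply hγ _).measurable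
  have hx : ∀ i : Fin (2 * p), Continuous fun s => inner ℝ (w s) (stdFrame p i) := fun i =>
    hw.inner continuous_const
  have hG : Continuous fun s => Matrix.of fun i j : Fin (2 * p) =>
      metricForm (γ s) (stdFrame p i) (stdFrame p j) :=
    continuous_matrix fun i j => hγ _
  simp only [dotProduct, Matrix.vecMul, Matrix.inv_def, Matrix.smul_apply, smul_eq_mul,
    Ring.inverse_eq_inv']
  refine Finset.measurable_sum _ fun i _ => Measurable.mul
    (Finset.measurable_sum _ fun j _ => ?_) (hx i).measurable
  exact (hx j).measurable.mul (hG.matrix_det.measurable.inv.mul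
    (hG.matrix_adjugate.matrix_elem j i).measurable)

/-! ### The divergence theorem on balls -/

section Divergence

variable {E : Type*} [NormedAddCommGroup E] [InnerProductSpace ℝ E] [FiniteDimensional ℝ E]
  [MeasurableSpace E] [BorelSpace E]

/-- Integration in polar coordinates. -/
theorem integral_eq_integral_Ioi_integral_toSphere (μ : Measure E) [μ.IsAddHaarMeasure]
    {f : E → ℝ} (hf : Integrable f μ) [Nontrivial E] :
    ∫ z, f z ∂μ = ∫ t in Set.Ioi (0 : ℝ), t ^ (Module.finrank ℝ E - 1) *
      ∫ w : Metric.sphere (0 : E) 1, f (t • (w : E)) ∂μ.toSphere := by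
  have hmp := μ.measurePreserving_homeomorphUnitSphereProd
  have hemb := (homeomorphUnitSphereProd E).measurableEmbedding
  set d := Module.finrank ℝ E - 1
  let F : Metric.sphere (0 : E) 1 × Set.Ioi (0 : ℝ) → ℝ := fun x => f ((x.2 : ℝ) • (x.1 : E))
  have hF : ∀ x : ({0}ᶜ : Set E), F (homeomorphUnitSphereProd E x) = f x := by
    intro x
    have hx : ‖(x : E)‖ ≠ 0 := norm_ne_zero_iff.2 x.2
    simp [F, smul_smul, hx]
  have hint : Integrable F (μ.toSphere.prod (.volumeIoiPow d)) := by
    rw [← hmp.integrable_comp_emb hemb]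
    have h1 : F ∘ homeomorphUnitSphereProd E = f ∘ ((↑) : ({0}ᶜ : Set E) → E) := funext hF
    rw [h1, ← integrableOn_iff_comap_subtypeVal (measurableSet_singleton _).compl]
    exact hf.integrableOn
  calc
    ∫ z, f z ∂μ = ∫ x : ({0}ᶜ : Set E), f x ∂(μ.comap (↑)) := by
      rw [integral_subtype_comap (measurableSet_singleton _).compl f,
        MeasureTheory.restrict_compl_singleton]
    _ = ∫ x, F x ∂μ.toSphere.prod (.volumeIoiPow d) := by
      rw [← hmp.integral_comp hemb]
      simp only [hF]
    _ = ∫ t, ∫ w, F (w, t) ∂μ.toSphere ∂(.volumeIoiPow d) := integral_prod_symm _ hint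
    _ = _ := by
      simp only [Measure.volumeIoiPow, ENNReal.ofReal]
      rw [integral_withDensity_eq_integral_smul,
        integral_subtype_comap measurableSet_Ioi fun a => Real.toNNReal (a ^ d) •
          ∫ w : Metric.sphere (0 : E) 1, f (a • (w : E)) ∂μ.toSphere,
        setIntegral_congr_fun measurableSet_Ioi fun x hx => ?_]
      · simp only [NNReal.smul_def, Real.coe_toNNReal _ (pow_nonneg (Set.mem_Ioi.1 hx).le _),
          smul_eq_mul]
      · exact (measurable_subtype_coe.pow_const _).real_toNNReal

variable {ι : Type*} [Fintype ι]

/-- Integration by parts against a radial cutoff function. -/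
theorem integral_cutoff_mul_sum_fderiv (μ : Measure E) [μ.IsAddHaarMeasure]
    (b : ι → E) {F : ι → E → ℝ} (hF : ∀ i, ContDiff ℝ 1 (F i)) {r : ℝ} (hr : 0 ≤ r)
    {h : ℝ → ℝ} (hh : ContDiff ℝ 1 h) (hz : ∀ s, r ^ 2 ≤ s → h s = 0) :
    ∫ z, h (‖z‖ ^ 2) * ∑ i, fderiv ℝ (F i) z (b i) ∂μ =
      ∫ z, -(2 * deriv h (‖z‖ ^ 2)) * ∑ i, inner ℝ (b i) z * F i z ∂μ := by
  have hχ : ContDiff ℝ 1 fun z : E => h (‖z‖ ^ 2) := hh.comp (contDiff_norm_sq ℝ)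
  have hsupp : HasCompactSupport fun z : E => h (‖z‖ ^ 2) := by
    refine HasCompactSupport.intro (isCompact_closedBall (0 : E) r) fun z hz' => hz _ ?_
    rw [mem_closedBall_zero_iff, not_le] at hz'
    gcongr
  have hder : ∀ z v : E, fderiv ℝ (fun z : E => h (‖z‖ ^ 2)) z v =
      2 * deriv h (‖z‖ ^ 2) * inner ℝ v z := by
    intro z v
    have h1 := (hh.differentiable one_ne_zero (‖z‖ ^ 2)).hasDerivAt.comp_hasFDerivAt z
      (hasStrictFDerivAt_norm_sq z).hasFDerivAt
    have h2 : HasFDerivAt (fun z : E => h (‖z‖ ^ 2)) _ z := h1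
    rw [h2.fderiv]
    simp [real_inner_comm]
    ring
  have hcF : ∀ i, Continuous (F i) := fun i => (hF i).continuous
  have hcdF : ∀ i, Continuous fun z => fderiv ℝ (F i) z (b i) := fun i =>
    ((hF i).continuous_fderiv one_ne_zero).clm_apply continuous_const
  have hcdχ : ∀ i, Continuous fun z => fderiv ℝ (fun z : E => h (‖z‖ ^ 2)) z (b i) := fun i =>
    (hχ.continuous_fderiv one_ne_zero).clm_apply continuous_const
  have hsupp' : ∀ i, HasCompactSupport fun z => fderiv ℝ (fun z : E => h (‖z‖ ^ 2)) z (b i) :=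
    fun i => hsupp.fderiv_apply (𝕜 := ℝ) (b i)
  have hI : ∀ i, Integrable (fun z => h (‖z‖ ^ 2) * fderiv ℝ (F i) z (b i)) μ := fun i =>
    (hχ.continuous.mul (hcdF i)).integrable_of_hasCompactSupport hsupp.mul_right
  have hI' : ∀ i, Integrable
      (fun z => fderiv ℝ (fun z : E => h (‖z‖ ^ 2)) z (b i) * F i z) μ := fun i =>
    ((hcdχ i).mul (hcF i)).integrable_of_hasCompactSupport (hsupp' i).mul_right
  have hI'' : ∀ i, Integrable (fun z => h (‖z‖ ^ 2) * F i z) μ := fun i =>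
    (hχ.continuous.mul (hcF i)).integrable_of_hasCompactSupport hsupp.mul_right
  simp only [Finset.mul_sum]
  have e1 : ∀ i z, -(2 * deriv h (‖z‖ ^ 2)) * (inner ℝ (b i) z * F i z) =
      -(fderiv ℝ (fun z : E => h (‖z‖ ^ 2)) z (b i) * F i z) := fun i z => by
    rw [hder]; ring
  simp only [e1]
  rw [integral_finsetSum _ fun i _ => hI i, integral_finsetSum (f := fun i z =>
    -(fderiv ℝ (fun z : E => h (‖z‖ ^ 2)) z (b i) * F i z)) _ fun i _ => (hI' i).neg]
  refine Finset.sum_congr rfl fun i _ => ?_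
  rw [integral_neg]
  exact integral_mul_fderiv_eq_neg_fderiv_mul_of_integrable (hI' i) (hI i) (hI'' i)
    (fun z _ => hχ.differentiable one_ne_zero z) (fun z _ => (hF i).differentiable one_ne_zero z)

/-- A weighted mean of a continuous function with nonnegative weights near `r` is close to the
value at `r`. -/
theorem abs_integral_weight_sub_le {ψ Φ : ℝ → ℝ} {ρ r ε : ℝ} (hρ : ρ ≤ r)
    (hψ : Continuous ψ) (hΦ : Continuous Φ) (hψ0 : ∀ t ∈ Set.Icc ρ r, 0 ≤ ψ t)
    (hψ1 : ∫ t in ρ..r, ψ t = 1) (hε : ∀ t ∈ Set.Icc ρ r, |Φ t - Φ r| ≤ ε) :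
    |(∫ t in ρ..r, ψ t * Φ t) - Φ r| ≤ ε := by
  have h1 : (∫ t in ρ..r, ψ t * Φ t) - Φ r = ∫ t in ρ..r, ψ t * (Φ t - Φ r) := by
    have h2 : Φ r = ∫ t in ρ..r, ψ t * Φ r := by
      rw [intervalIntegral.integral_mul_const, hψ1, one_mul]
    conv_lhs => rw [h2]
    simp only [mul_sub]
    exact (intervalIntegral.integral_sub ((hψ.mul hΦ).intervalIntegrable _ _)
      ((hψ.mul continuous_const).intervalIntegrable _ _)).symm
  have h3 : ∫ t in ρ..r, ψ t * ε = ε := by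
    rw [intervalIntegral.integral_mul_const, hψ1, one_mul]
  rw [h1]
  refine (intervalIntegral.abs_integral_le_integral_abs hρ).trans ?_
  conv_rhs => rw [← h3]
  refine intervalIntegral.integral_mono_on hρ
    ((hψ.mul (hΦ.sub continuous_const)).abs.intervalIntegrable _ _)
    ((hψ.mul continuous_const).intervalIntegrable _ _) fun t ht => ?_
  rw [abs_mul, abs_of_nonneg (hψ0 t ht)]
  exact mul_le_mul_of_nonneg_left (hε t ht) (hψ0 t ht)

/-- A smooth function of `s` that is `1` for `s ≤ ρ ^ 2` and `0` for `s ≥ r ^ 2`. -/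
noncomputable def cutoff (ρ r s : ℝ) : ℝ :=
  Real.smoothTransition ((r ^ 2 - s) / (r ^ 2 - ρ ^ 2))

theorem contDiff_cutoff (ρ r : ℝ) : ContDiff ℝ 1 (cutoff ρ r) :=
  Real.smoothTransition.contDiff.comp ((contDiff_const.sub contDiff_id).div_const _)

theorem cutoff_eq_zero {ρ r s : ℝ} (h0 : 0 ≤ ρ) (h : ρ < r) (hs : r ^ 2 ≤ s) :
    cutoff ρ r s = 0 := by
  refine Real.smoothTransition.zero_of_nonpos (div_nonpos_of_nonpos_of_nonneg (by linarith) ?_)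
  have : ρ ^ 2 < r ^ 2 := by gcongr
  linarith

theorem cutoff_eq_one {ρ r s : ℝ} (h0 : 0 ≤ ρ) (h : ρ < r) (hs : s ≤ ρ ^ 2) :
    cutoff ρ r s = 1 := by
  have : ρ ^ 2 < r ^ 2 := by gcongr
  refine Real.smoothTransition.one_of_one_le ?_
  rw [le_div_iff₀ (by linarith)]
  linarith

theorem antitone_cutoff {ρ r : ℝ} (h0 : 0 ≤ ρ) (h : ρ < r) : Antitone (cutoff ρ r) := by
  have : ρ ^ 2 < r ^ 2 := by gcongr
  intro s t hst
  refine Real.smoothTransition.monotone ?_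
  gcongr

theorem deriv_cutoff_eq_zero {ρ r s : ℝ} (h0 : 0 ≤ ρ) (h : ρ < r)
    (hs : s < ρ ^ 2 ∨ r ^ 2 < s) : deriv (cutoff ρ r) s = 0 := by
  rcases hs with hs | hs
  · have : cutoff ρ r =ᶠ[𝓝 s] fun _ => 1 := by
      filter_upwards [Iio_mem_nhds hs] with t ht using cutoff_eq_one h0 h (Set.mem_Iio.1 ht).le
    rw [this.deriv_eq]; simp
  · have : cutoff ρ r =ᶠ[𝓝 s] fun _ => 0 := by
      filter_upwards [Ioi_mem_nhds hs] with t ht using cutoff_eq_zero h0 h (Set.mem_Ioi.1 ht).le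
    rw [this.deriv_eq]; simp

/-- The divergence theorem on a ball. It is obtained from integration by parts against radial
cutoff functions, in polar coordinates. -/
theorem integral_ball_sum_fderiv [Nontrivial E] (μ : Measure E) [μ.IsAddHaarMeasure]
    (b : ι → E) {F : ι → E → ℝ} (hF : ∀ i, ContDiff ℝ 1 (F i)) {r : ℝ} (hr : 0 < r) :
    ∫ z in Metric.ball 0 r, ∑ i, fderiv ℝ (F i) z (b i) ∂μ =
      r ^ (Module.finrank ℝ E - 1) * ∫ w : Metric.sphere (0 : E) 1,
        ∑ i, inner ℝ (b i) (w : E) * F i (r • (w : E)) ∂μ.toSphere := by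
  set d := Module.finrank ℝ E - 1
  set Φ : ℝ → ℝ := fun t => t ^ d * ∫ w : Metric.sphere (0 : E) 1,
        ∑ i, inner ℝ (b i) (w : E) * F i (t • (w : E)) ∂μ.toSphere with hΦdef
  change _ = Φ r
  have hcF : ∀ i, Continuous (F i) := fun i => (hF i).continuous
  have hcdF : ∀ i, Continuous fun z => fderiv ℝ (F i) z (b i) := fun i =>
    ((hF i).continuous_fderiv one_ne_zero).clm_apply continuous_const
  have hΦ : Continuous Φ := by
    refine (continuous_pow d).mul ?_
    have := continuous_parametric_integral_of_continuous (μ := μ.toSphere)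
      (f := fun (t : ℝ) (w : Metric.sphere (0 : E) 1) =>
        ∑ i, inner ℝ (b i) (w : E) * F i (t • (w : E)))
      (continuous_finsetSum _ fun i _ => by
        have := hcF i
        fun_prop) (isCompact_univ)
    simpa using this
  -- Against the cutoff, the divergence has as its integral a weighted mean of `Φ` over `[ρ, r]`.
  have key : ∀ ρ, 0 < ρ → ρ < r →
      ∫ z, cutoff ρ r (‖z‖ ^ 2) * ∑ i, fderiv ℝ (F i) z (b i) ∂μ =
        ∫ t in ρ..r, -(2 * t * deriv (cutoff ρ r) (t ^ 2)) * Φ t := by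
    intro ρ h0' hρ
    have h0 := h0'.le
    have hcd : Continuous (deriv (cutoff ρ r)) :=
      (contDiff_cutoff ρ r).continuous_deriv le_rfl
    rw [integral_cutoff_mul_sum_fderiv μ b hF hr.le (contDiff_cutoff ρ r)
      fun s hs => cutoff_eq_zero h0 hρ hs]
    rw [integral_eq_integral_Ioi_integral_toSphere]
    · have hsph : ∀ t, 0 < t → t ^ d * ∫ w : Metric.sphere (0 : E) 1,
          -(2 * deriv (cutoff ρ r) (‖t • (w : E)‖ ^ 2)) *
            ∑ i, inner ℝ (b i) (t • (w : E)) * F i (t • (w : E)) ∂μ.toSphere =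
          -(2 * t * deriv (cutoff ρ r) (t ^ 2)) * Φ t := by
        intro t ht0
        have hn : ∀ w : Metric.sphere (0 : E) 1, ‖t • (w : E)‖ = t := fun w => by
          rw [norm_smul, norm_eq_of_mem_sphere w, mul_one, Real.norm_of_nonneg ht0.le]
        simp only [hn, inner_smul_right, mul_assoc, ← Finset.mul_sum, hΦdef]
        rw [integral_const_mul, integral_const_mul]
        ring
      rw [setIntegral_congr_fun measurableSet_Ioi fun t ht => hsph t ht,
        intervalIntegral.integral_of_le hρ.le, ← integral_Icc_eq_integral_Ioc]
      refine setIntegral_eq_of_subset_of_forall_sdiff_eq_zero measurableSet_Ioi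
        (fun t ht => h0'.trans_le ht.1) fun t ht => ?_
      have ht0 : 0 < t := ht.1
      have : t < ρ ∨ r < t := by
        by_contra hle
        push Not at hle
        exact ht.2 hle
      rw [deriv_cutoff_eq_zero h0 hρ (this.imp (fun h => by gcongr) (fun h => by gcongr))]
      simp
    · refine Continuous.integrable_of_hasCompactSupport ?_ ?_
      · refine Continuous.mul ?_ (continuous_finsetSum _ fun i _ => ?_)
        · fun_prop
        · have := hcF i
          fun_prop
      · refine HasCompactSupport.intro (isCompact_closedBall (0 : E) r) fun z hz => ?_
        rw [mem_closedBall_zero_iff, not_le] at hz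
        rw [deriv_cutoff_eq_zero h0 hρ (Or.inr (by gcongr))]
        simp
  have hev : ∀ᶠ ρ in 𝓝[<] r, 0 < ρ ∧ ρ < r := by
    filter_upwards [Ioo_mem_nhdsLT hr] with ρ hρ using hρ
  have hlim1 : Tendsto (fun ρ => ∫ z, cutoff ρ r (‖z‖ ^ 2) * ∑ i, fderiv ℝ (F i) z (b i) ∂μ)
      (𝓝[<] r) (𝓝 (∫ z in Metric.ball 0 r, ∑ i, fderiv ℝ (F i) z (b i) ∂μ)) := by
    rw [← integral_indicator measurableSet_ball]
    have hcD : Continuous fun z => ∑ i, fderiv ℝ (F i) z (b i) :=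
      continuous_finsetSum _ fun i _ => hcdF i
    refine tendsto_integral_filter_of_dominated_convergence
      ((Metric.ball (0 : E) r).indicator fun z => |∑ i, fderiv ℝ (F i) z (b i)|) ?_ ?_ ?_ ?_
    · refine Eventually.of_forall fun ρ => Continuous.aestronglyMeasurable ?_
      exact ((contDiff_cutoff ρ r).continuous.comp (continuous_norm.pow 2)).mul hcD
    · filter_upwards [hev] with ρ hρ
      refine Eventually.of_forall fun z => ?_
      by_cases hz : z ∈ Metric.ball (0 : E) r
      · rw [Set.indicator_of_mem hz, norm_mul, Real.norm_eq_abs, Real.norm_eq_abs]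
        refine mul_le_of_le_one_left (abs_nonneg _) ?_
        rw [cutoff, abs_of_nonneg (Real.smoothTransition.nonneg _)]
        exact Real.smoothTransition.le_one _
      · rw [Set.indicator_of_notMem hz, cutoff_eq_zero hρ.1.le hρ.2]
        · simp
        · rw [mem_ball_zero_iff, not_lt] at hz
          gcongr
    · rw [integrable_indicator_iff measurableSet_ball]
      exact (hcD.abs.continuousOn.integrableOn_compact (isCompact_closedBall 0 r)).mono_set
        Metric.ball_subset_closedBall
    · refine Eventually.of_forall fun z => ?_
      by_cases hz : z ∈ Metric.ball (0 : E) r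
      · rw [Set.indicator_of_mem hz]
        refine tendsto_const_nhds.congr' ?_
        rw [mem_ball_zero_iff] at hz
        filter_upwards [hev, Ioo_mem_nhdsLT hz] with ρ hρ hρ'
        rw [cutoff_eq_one hρ.1.le hρ.2, one_mul]
        have := hρ'.1.le
        gcongr
      · rw [Set.indicator_of_notMem hz]
        refine tendsto_const_nhds.congr' ?_
        filter_upwards [hev] with ρ hρ
        rw [cutoff_eq_zero hρ.1.le hρ.2, zero_mul]
        rw [mem_ball_zero_iff, not_lt] at hz
        gcongr
  -- The weight is minus the derivative of `t ↦ cutoff ρ r (t ^ 2)`: nonnegative and of mass one.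
  have hlim2 : Tendsto (fun ρ => ∫ t in ρ..r, -(2 * t * deriv (cutoff ρ r) (t ^ 2)) * Φ t)
      (𝓝[<] r) (𝓝 (Φ r)) := by
    rw [Metric.tendsto_nhds]
    intro ε hε
    obtain ⟨δ, hδ, hδ'⟩ :=
      Metric.continuousAt_iff.1 (hΦ.continuousAt (x := r)) (ε / 2) (by positivity)
    filter_upwards [hev, Ioo_mem_nhdsLT (show r - δ < r by linarith)] with ρ hρ hρ'
    have hcd : Continuous (deriv (cutoff ρ r)) :=
      (contDiff_cutoff ρ r).continuous_deriv le_rfl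
    have hψ : Continuous fun t => -(2 * t * deriv (cutoff ρ r) (t ^ 2)) := by fun_prop
    refine lt_of_le_of_lt (abs_integral_weight_sub_le hρ.2.le hψ hΦ ?_ ?_ (ε := ε / 2) ?_)
      (by linarith)
    · intro t ht
      have h1 : deriv (cutoff ρ r) (t ^ 2) ≤ 0 := (antitone_cutoff hρ.1.le hρ.2).deriv_nonpos
      have h2 : 0 ≤ t := hρ.1.le.trans ht.1
      have := mul_nonneg h2 (neg_nonneg.2 h1)
      linarith
    · have hder : ∀ t, HasDerivAt (fun t => -cutoff ρ r (t ^ 2))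
          (-(2 * t * deriv (cutoff ρ r) (t ^ 2))) t := by
        intro t
        have h1 := ((contDiff_cutoff ρ r).differentiable one_ne_zero (t ^ 2)).hasDerivAt.comp t
          (hasDerivAt_pow 2 t)
        refine h1.neg.congr_deriv ?_
        norm_num
        ring
      rw [intervalIntegral.integral_eq_sub_of_hasDerivAt (fun t _ => hder t)
        (hψ.intervalIntegrable _ _), cutoff_eq_zero hρ.1.le hρ.2 le_rfl,
        cutoff_eq_one hρ.1.le hρ.2 le_rfl]
      norm_num
    · intro t ht
      refine (hδ' ?_).le
      rw [Real.dist_eq, abs_lt]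
      constructor <;> linarith [ht.1, ht.2, hρ'.1]
  exact tendsto_nhds_unique hlim1 (hlim2.congr' (by
    filter_upwards [hev] with ρ hρ using (key ρ hρ.1 hρ.2).symm))

end Divergence

/-- Stokes' theorem on a ball of `ℂᵖ`. -/
theorem integral_ball_extDeriv {p d : ℕ} (h : d + 1 = 2 * p)
    {ζ : Cn p → Cn p [⋀^Fin d]→L[ℝ] ℝ} (hζ : Differentiable ℝ ζ)
    (happ : ∀ v, ContDiff ℝ 1 fun z => ζ z v) {r : ℝ} (hr : 0 < r) :
    ∫ z in Metric.ball (0 : Cn p) r, extDeriv ζ z (fun k : Fin (d + 1) => stdFrame p k) =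
      r ^ (2 * p - 1) * ∫ w : Metric.sphere (0 : Cn p) 1, fluxDensity (w : Cn p) (ζ (r • (w : Cn p)))
        ∂(volume : Measure (Cn p)).toSphere := by
  have : Nontrivial (Cn p) := by
    apply Module.nontrivial_of_finrank_pos (R := ℝ)
    rw [finrank_real_Cn]; omega
  set F : Fin (d + 1) → Cn p → ℝ := fun i z =>
    (-1) ^ (i : ℕ) * ζ z (i.removeNth fun k : Fin (d + 1) => stdFrame p k)
  have hF : ∀ i, ContDiff ℝ 1 (F i) := fun i => contDiff_const.mul (happ _)
  have h1 := integral_ball_sum_fderiv volume (fun i : Fin (d + 1) => stdFrame p i) hF hr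
  rw [finrank_real_Cn] at h1
  have h2 : ∀ z, extDeriv ζ z (fun k : Fin (d + 1) => stdFrame p k) =
      ∑ i : Fin (d + 1), fderiv ℝ (F i) z (stdFrame p i) := by
    intro z
    rw [extDeriv_apply (hζ z)]
    refine Finset.sum_congr rfl fun i _ => ?_
    rw [fderiv_const_mul ((happ _).differentiable one_ne_zero z)]
    simp
  simp only [h2, h1, fluxDensity_eq_sum h]
  congr 2
  funext w
  refine Finset.sum_congr rfl fun i _ => ?_
  rw [real_inner_comm (w : Cn p)]
  simp only [F]
  ring

/-! ### Pullback of forms under holomorphic maps -/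

section Manifold

variable {L M N : Type*} {l m n k : ℕ} [TopologicalSpace L] [ChartedSpace (Cn l) L]
  [TopologicalSpace M] [ChartedSpace (Cn m) M] [TopologicalSpace N] [ChartedSpace (Cn n) N]

theorem dif_comp {g : M → N} {f : L → M} {z : L}
    (hg : MDifferentiableAt 𝓘(ℂ, Cn m) 𝓘(ℂ, Cn n) g (f z))
    (hf : MDifferentiableAt 𝓘(ℂ, Cn l) 𝓘(ℂ, Cn m) f z) :
    dif (m := l) (n := n) (g ∘ f) z = (dif (m := m) (n := n) g (f z)).comp (dif f z) :=
  mfderiv_comp z hg hf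

theorem pullback_apply (f : M → N) (α : DiffForm N n k) (z : M) (v : Fin k → Cn m) :
    pullback (m := m) f α z v = α (f z) (fun i => dif (m := m) (n := n) f z (v i)) := rfl

theorem pullback_comp {g : M → N} {f : L → M}
    (hg : MDifferentiable 𝓘(ℂ, Cn m) 𝓘(ℂ, Cn n) g)
    (hf : MDifferentiable 𝓘(ℂ, Cn l) 𝓘(ℂ, Cn m) f) (α : DiffForm N n k) :
    pullback (m := l) (g ∘ f) α = pullback (m := l) f (pullback (m := m) g α) := by
  funext z
  ext v
  simp only [pullback_apply, dif_comp (hg _) (hf _)]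
  rfl

theorem dif_eq_fderiv (f : Cn m → Cn n) (z : Cn m) : dif (m := m) (n := n) f z = fderiv ℂ f z :=
  mfderiv_eq_fderiv

theorem contMDiffAt_chartAt [IsManifold 𝓘(ℂ, Cn n) ω N] {x y : N}
    (hy : y ∈ (chartAt (Cn n) x).source) :
    ContMDiffAt 𝓘(ℂ, Cn n) 𝓘(ℂ, Cn n) ω (chartAt (Cn n) x) y :=
  contMDiffOn_chart.contMDiffAt ((chartAt (Cn n) x).open_source.mem_nhds hy)

theorem contMDiffAt_chartAt_symm [IsManifold 𝓘(ℂ, Cn n) ω N] {x : N} {u : Cn n}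
    (hu : u ∈ (chartAt (Cn n) x).target) :
    ContMDiffAt 𝓘(ℂ, Cn n) 𝓘(ℂ, Cn n) ω (chartAt (Cn n) x).symm u :=
  contMDiffOn_chart_symm.contMDiffAt ((chartAt (Cn n) x).open_target.mem_nhds hu)

/-- A holomorphic map in the chart at a point of the target. -/
theorem contDiffAt_chartAt_comp [IsManifold 𝓘(ℂ, Cn n) ω N] {f : Cn m → N}
    (hf : ContMDiff 𝓘(ℂ, Cn m) 𝓘(ℂ, Cn n) ω f) {x : N} {z : Cn m}
    (hz : f z ∈ (chartAt (Cn n) x).source) : ContDiffAt ℂ ω (chartAt (Cn n) x ∘ f) z :=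
  ((contMDiffAt_chartAt hz).comp z (hf z)).contDiffAt

theorem dif_chartAt_comp [IsManifold 𝓘(ℂ, Cn n) ω N] {f : Cn m → N}
    (hf : ContMDiff 𝓘(ℂ, Cn m) 𝓘(ℂ, Cn n) ω f) {x : N} {z : Cn m}
    (hz : f z ∈ (chartAt (Cn n) x).source) :
    fderiv ℂ (chartAt (Cn n) x ∘ f) z =
      (dif (m := n) (n := n) (chartAt (Cn n) x) (f z)).comp (dif (m := m) (n := n) f z) := by
  rw [← dif_eq_fderiv]
  exact dif_comp ((contMDiffAt_chartAt hz).mdifferentiableAt (by simp))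
    ((hf z).mdifferentiableAt (by simp))

theorem dif_chartAt_symm_comp_dif_chartAt [IsManifold 𝓘(ℂ, Cn n) ω N] {x y : N}
    (hy : y ∈ (chartAt (Cn n) x).source) (v : Cn n) :
    dif (m := n) (n := n) (chartAt (Cn n) x).symm (chartAt (Cn n) x y)
      (dif (m := n) (n := n) (chartAt (Cn n) x) y v) = v := by
  have hu := (chartAt (Cn n) x).map_source hy
  have h := dif_comp (l := n) (z := y) (g := (chartAt (Cn n) x).symm) (f := chartAt (Cn n) x)
    ((contMDiffAt_chartAt_symm hu).mdifferentiableAt (by simp))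
    ((contMDiffAt_chartAt hy).mdifferentiableAt (by simp))
  have h2 : ((chartAt (Cn n) x).symm ∘ chartAt (Cn n) x) =ᶠ[𝓝 y] id := by
    filter_upwards [(chartAt (Cn n) x).open_source.mem_nhds hy] with t ht
      using (chartAt (Cn n) x).left_inv ht
  have h3 : dif (m := n) (n := n) ((chartAt (Cn n) x).symm ∘ chartAt (Cn n) x) y =
      ContinuousLinearMap.id ℂ (Cn n) := h2.mfderiv_eq.trans mfderiv_id
  rw [h3] at h
  exact (DFunLike.congr_fun h v).symm

theorem dif_chartAt_comp_dif_chartAt_symm [IsManifold 𝓘(ℂ, Cn n) ω N] {x : N} {u : Cn n}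
    (hu : u ∈ (chartAt (Cn n) x).target) (v : Cn n) :
    dif (m := n) (n := n) (chartAt (Cn n) x) ((chartAt (Cn n) x).symm u)
      (dif (m := n) (n := n) (chartAt (Cn n) x).symm u v) = v := by
  have hy := (chartAt (Cn n) x).map_target hu
  have h := dif_comp (l := n) (z := u) (g := chartAt (Cn n) x) (f := (chartAt (Cn n) x).symm)
    ((contMDiffAt_chartAt hy).mdifferentiableAt (by simp))
    ((contMDiffAt_chartAt_symm hu).mdifferentiableAt (by simp))
  have h2 : (chartAt (Cn n) x ∘ (chartAt (Cn n) x).symm) =ᶠ[𝓝 u] id := by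
    filter_upwards [(chartAt (Cn n) x).open_target.mem_nhds hu] with t ht
      using (chartAt (Cn n) x).right_inv ht
  have h3 : dif (m := n) (n := n) (chartAt (Cn n) x ∘ (chartAt (Cn n) x).symm) u =
      ContinuousLinearMap.id ℂ (Cn n) := h2.mfderiv_eq.trans mfderiv_id
  rw [h3] at h
  exact (DFunLike.congr_fun h v).symm

/-- The local expression of a form in the chart at `x`. -/
noncomputable abbrev localForm (α : DiffForm N n k) (x : N) : Cn n → Cn n [⋀^Fin k]→L[ℝ] ℝ :=
  pullback (m := n) (chartAt (Cn n) x).symm α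

theorem apply_eq_localForm [IsManifold 𝓘(ℂ, Cn n) ω N] (α : DiffForm N n k) {x y : N}
    (hy : y ∈ (chartAt (Cn n) x).source) (v : Fin k → Cn n) :
    α y v = localForm α x (chartAt (Cn n) x y)
      (fun i => dif (m := n) (n := n) (chartAt (Cn n) x) y (v i)) := by
  simp only [localForm, pullback_apply, dif_chartAt_symm_comp_dif_chartAt hy,
    (chartAt (Cn n) x).left_inv hy]

/-- The pullback of a form under a holomorphic map `f : ℂᵐ → N`, in terms of the local expressions
of the form and of `f`. -/
theorem pullback_eventuallyEq [IsManifold 𝓘(ℂ, Cn n) ω N] {f : Cn m → N}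
    (hf : ContMDiff 𝓘(ℂ, Cn m) 𝓘(ℂ, Cn n) ω f) (α : DiffForm N n k) (z₀ : Cn m) :
    pullback (m := m) f α =ᶠ[𝓝 z₀] fun z =>
      (localForm α (f z₀) ((chartAt (Cn n) (f z₀) ∘ f) z)).compContinuousLinearMap
        (fderiv ℝ (chartAt (Cn n) (f z₀) ∘ f) z) := by
  have hU : f ⁻¹' (chartAt (Cn n) (f z₀)).source ∈ 𝓝 z₀ :=
    hf.continuous.continuousAt.preimage_mem_nhds (chart_source_mem_nhds _ _)
  filter_upwards [hU] with z hz
  have hd := (contDiffAt_chartAt_comp hf hz).differentiableAt (by simp)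
  ext v
  rw [pullback_apply, apply_eq_localForm α hz, hd.fderiv_restrictScalars ℝ,
    dif_chartAt_comp hf hz]
  rfl

theorem contDiffAt_localForm {α : DiffForm N n k} (hα : IsSmoothForm α) (x : N) :
    ContDiffAt ℝ ∞ (localForm α x) (chartAt (Cn n) x x) :=
  (hα x).contDiffAt ((chartAt (Cn n) x).open_target.mem_nhds (mem_chart_target _ x))

theorem contDiffAt_real_chartAt_comp [IsManifold 𝓘(ℂ, Cn n) ω N] {f : Cn m → N}
    (hf : ContMDiff 𝓘(ℂ, Cn m) 𝓘(ℂ, Cn n) ω f) (z₀ : Cn m) :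
    ContDiffAt ℝ ω (chartAt (Cn n) (f z₀) ∘ f) z₀ :=
  (contDiffAt_chartAt_comp hf (mem_chart_source _ _)).restrict_scalars ℝ

theorem differentiable_pullback [IsManifold 𝓘(ℂ, Cn n) ω N] {f : Cn m → N}
    (hf : ContMDiff 𝓘(ℂ, Cn m) 𝓘(ℂ, Cn n) ω f) {α : DiffForm N n k} (hα : IsSmoothForm α) :
    Differentiable ℝ (pullback (m := m) f α) := by
  intro z₀
  refine DifferentiableAt.congr_of_eventuallyEq ?_ (pullback_eventuallyEq hf α z₀)
  have hg := contDiffAt_real_chartAt_comp hf z₀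
  refine DifferentiableAt.continuousAlternatingMapCompContinuousLinearMap ?_ ?_
  · exact ((contDiffAt_localForm hα (f z₀)).differentiableAt (by simp)).comp z₀
      (hg.differentiableAt (by simp))
  · exact (hg.fderiv_right (m := 1) (by simp)).differentiableAt (by simp)

theorem contDiff_pullback_apply [IsManifold 𝓘(ℂ, Cn n) ω N] {f : Cn m → N}
    (hf : ContMDiff 𝓘(ℂ, Cn m) 𝓘(ℂ, Cn n) ω f) {α : DiffForm N n k} (hα : IsSmoothForm α)
    (v : Fin k → Cn m) : ContDiff ℝ 1 fun z => pullback (m := m) f α z v := by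
  rw [contDiff_iff_contDiffAt]
  intro z₀
  have hg := contDiffAt_real_chartAt_comp hf z₀
  have h1 : ContDiffAt ℝ 1 (fderiv ℝ (chartAt (Cn n) (f z₀) ∘ f)) z₀ :=
    hg.fderiv_right (m := 1) (by simp)
  have h2 : ContDiffAt ℝ 1 (fun z => localForm α (f z₀) ((chartAt (Cn n) (f z₀) ∘ f) z)) z₀ :=
    ((contDiffAt_localForm hα (f z₀)).of_le (by simp)).comp z₀ (hg.of_le (by simp))
  have h3 : ContDiffAt ℝ 1 (fun z =>
      ContinuousMultilinearMap.compContinuousLinearMapContinuousMultilinear ℝ (fun _ : Fin k => Cn m)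
        (fun _ : Fin k => Cn n) ℝ (fun _ => fderiv ℝ (chartAt (Cn n) (f z₀) ∘ f) z)
        (ContinuousAlternatingMap.toContinuousMultilinearMapCLM ℝ
          (localForm α (f z₀) ((chartAt (Cn n) (f z₀) ∘ f) z)))) z₀ :=
    ((ContinuousMultilinearMap.contDiff _).contDiffAt.comp z₀
      (contDiffAt_pi.2 fun _ => h1)).clm_apply
      ((ContinuousLinearMap.contDiff _).contDiffAt.comp z₀ h2)
  have h4 := (ContinuousMultilinearMap.apply ℝ (fun _ : Fin k => Cn m) ℝ v).contDiff.contDiffAt.comp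
    z₀ h3
  refine h4.congr_of_eventuallyEq ?_
  filter_upwards [pullback_eventuallyEq hf α z₀] with z hz
  rw [hz]
  rfl

/-- The exterior derivative commutes with the pullback under a holomorphic map `f`. As `extD` is
computed at `f z₀` in the chart at `f z₀`, which is also the chart in which `f` is expressed near
`z₀`, no independence of charts is needed. -/
theorem extDeriv_pullback_eq [IsManifold 𝓘(ℂ, Cn n) ω N] {f : Cn m → N}
    (hf : ContMDiff 𝓘(ℂ, Cn m) 𝓘(ℂ, Cn n) ω f) {α : DiffForm N n k} (hα : IsSmoothForm α) :
    extDeriv (pullback (m := m) f α) = pullback (m := m) f (extD α) := by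
  funext z₀
  have hg := contDiffAt_real_chartAt_comp hf z₀
  have hz := mem_chart_source (Cn n) (f z₀)
  rw [(pullback_eventuallyEq hf α z₀).extDeriv_eq,
    extDeriv_pullback (𝕜 := ℝ) (f := chartAt (Cn n) (f z₀) ∘ f)
      ((contDiffAt_localForm hα (f z₀)).differentiableAt (by simp)) hg le_top]
  have hd := (contDiffAt_chartAt_comp hf hz).differentiableAt (by simp)
  ext v
  rw [hd.fderiv_restrictScalars ℝ, dif_chartAt_comp hf hz]
  rfl

end Manifold

/-! ### Lifting to the universal covering -/

/-- A holomorphic map from `ℂᵖ` lifts to a holomorphic map to the universal covering. -/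
theorem exists_lift {X Y : Type*} {n p : ℕ} [TopologicalSpace X] [ChartedSpace (Cn n) X]
    [TopologicalSpace Y] [ChartedSpace (Cn n) Y] {π : Y → X} (hπ : IsUniversalCovering n π)
    {f : Cn p → X} (hf : ContMDiff 𝓘(ℂ, Cn p) 𝓘(ℂ, Cn n) ω f) :
    ∃ F : Cn p → Y, ContMDiff 𝓘(ℂ, Cn p) 𝓘(ℂ, Cn n) ω F ∧ π ∘ F = f := by
  obtain ⟨y₀, hy₀⟩ := hπ.surjective (f 0)
  obtain ⟨F, ⟨-, hF⟩, -⟩ := hπ.isCoveringMap.existsUnique_continuousMap_lifts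
    (⟨f, hf.continuous⟩ : C(Cn p, X)) 0 y₀ hy₀
  have hF' : ∀ z, π (F z) = f z := fun z => congrFun hF z
  refine ⟨F, fun z => ?_, hF⟩
  have hloc := hπ.isLocalDiffeomorph (F z)
  have h1 : ContMDiffAt 𝓘(ℂ, Cn n) 𝓘(ℂ, Cn n) ω hloc.localInverse (f z) := by
    rw [← hF' z]
    exact hloc.localInverse_contMDiffAt
  refine (h1.comp z (hf z)).congr_of_eventuallyEq ?_
  have h2 := hloc.localInverse_eventuallyEq_left
  filter_upwards [F.continuous.continuousAt.eventually h2] with w hw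
  simp only [Function.comp_apply] at hw ⊢
  rw [← hF' w]
  exact hw.symm

/-! ### Comparison of Hermitian metrics on a compact manifold -/

section Comparison

variable {X : Type*} {n : ℕ} [TopologicalSpace X] [ChartedSpace (Cn n) X]
  [IsManifold 𝓘(ℂ, Cn n) ω X]

theorem exists_form_le_local {α β : DiffForm X n 2} (hα : IsSmoothForm α)
    (hβ : IsHermitianMetric β) (x : X) :
    ∃ C : ℝ, ∀ᶠ y in 𝓝 x, ∀ v, α y ![v, Complex.I • v] ≤ C * β y ![v, Complex.I • v] := by
  have htn : (chartAt (Cn n) x).target ∈ 𝓝 (chartAt (Cn n) x x) :=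
    (chartAt (Cn n) x).open_target.mem_nhds (mem_chart_target _ x)
  obtain ⟨K, hKn, hKt, hK⟩ := local_compact_nhds htn
  have hcont : ∀ γ : DiffForm X n 2, IsSmoothForm γ → ContinuousOn
      (fun q : Cn n × Cn n => localForm γ x q.1 ![q.2, Complex.I • q.2])
      (K ×ˢ Metric.sphere (0 : Cn n) 1) := by
    intro γ hγ
    have h1 : ContinuousOn (fun q : Cn n × Cn n => localForm γ x q.1)
        (K ×ˢ Metric.sphere (0 : Cn n) 1) :=
      (hγ x).continuousOn.comp (continuous_fst.continuousOn) fun q hq => hKt hq.1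
    have h2 : Continuous fun q : Cn n × Cn n => ![q.2, Complex.I • q.2] := by
      refine continuous_pi fun i => ?_
      fin_cases i
      · exact continuous_snd
      · exact (continuous_const_smul Complex.I).comp continuous_snd
    exact h1.eval h2.continuousOn
  have hpos : ∀ q ∈ K ×ˢ Metric.sphere (0 : Cn n) 1,
      0 < localForm β x q.1 ![q.2, Complex.I • q.2] := by
    rintro ⟨u, v⟩ ⟨hu, hv⟩
    have hv0 : v ≠ 0 := ne_zero_of_mem_unit_sphere ⟨v, hv⟩
    have hdv : dif (m := n) (n := n) (chartAt (Cn n) x).symm u v ≠ 0 := by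
      intro h0
      have := dif_chartAt_comp_dif_chartAt_symm (hKt hu) v
      rw [h0, map_zero] at this
      exact hv0 this.symm
    have := hβ.pos ((chartAt (Cn n) x).symm u) _ hdv
    rw [← map_smul] at this
    refine this.trans_eq ?_
    rw [localForm, pullback_apply]
    congr 1
    funext i
    fin_cases i <;> rfl
  obtain ⟨C, hC⟩ := (hK.prod (isCompact_sphere (0 : Cn n) 1)).exists_bound_of_continuousOn
    ((hcont α hα).div (hcont β hβ.smooth) fun q hq => (hpos q hq).ne')
  refine ⟨C, ?_⟩
  have hev : ∀ᶠ y in 𝓝 x, chartAt (Cn n) x y ∈ K :=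
    ((chartAt (Cn n) x).continuousAt (mem_chart_source _ x)).preimage_mem_nhds hKn
  filter_upwards [hev, chart_source_mem_nhds (Cn n) x] with y hyK hys v
  set w := dif (m := n) (n := n) (chartAt (Cn n) x) y v
  have hloc : ∀ γ : DiffForm X n 2, γ y ![v, Complex.I • v] =
      localForm γ x (chartAt (Cn n) x y) ![w, Complex.I • w] := by
    intro γ
    rw [apply_eq_localForm γ hys]
    congr 1
    funext i
    fin_cases i
    · rfl
    · exact map_smul _ _ _
  rw [hloc, hloc]
  rw [← metricForm_apply, ← metricForm_apply]
  by_cases hw : w = 0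
  · simp [hw]
  have hn : ‖w‖ ≠ 0 := norm_ne_zero_iff.2 hw
  have hmem : (chartAt (Cn n) x y, ‖w‖⁻¹ • w) ∈ K ×ˢ Metric.sphere (0 : Cn n) 1 :=
    ⟨hyK, by simp [norm_smul, hn]⟩
  have h1 := (le_abs_self _).trans (hC _ hmem)
  have h2 := hpos _ hmem
  simp only [Pi.div_apply] at h1
  rw [div_le_iff₀ h2] at h1
  simp only [← metricForm_apply, map_smul, LinearMap.smul_apply, smul_eq_mul] at h1
  have h3 : 0 < ‖w‖⁻¹ * ‖w‖⁻¹ := by positivity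
  refine le_of_mul_le_mul_left ?_ h3
  linarith

/-- A smooth form on a compact manifold is dominated by any Hermitian metric. -/
theorem exists_form_le [CompactSpace X] {α β : DiffForm X n 2} (hα : IsSmoothForm α)
    (hβ : IsHermitianMetric β) :
    ∃ C : ℝ, 0 ≤ C ∧ ∀ y v, α y ![v, Complex.I • v] ≤ C * β y ![v, Complex.I • v] := by
  choose C hC using exists_form_le_local hα hβ
  obtain ⟨t, ht⟩ := isCompact_univ.elim_nhds_subcover (fun x => {y | ∀ v,
    α y ![v, Complex.I • v] ≤ C x * β y ![v, Complex.I • v]}) fun x _ => hC x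
  refine ⟨∑ x ∈ t, |C x|, Finset.sum_nonneg fun _ _ => abs_nonneg _, fun y v => ?_⟩
  obtain ⟨x, hx, hy⟩ := Set.mem_iUnion₂.1 (ht.2 (Set.mem_univ y))
  refine (hy v).trans (mul_le_mul_of_nonneg_right ?_ (hβ.nonneg y v))
  exact (le_abs_self _).trans
    (Finset.single_le_sum (f := fun x => |C x|) (fun _ _ => abs_nonneg _) hx)

end Comparison

/-! ### The isoperimetric inequality and the conclusion -/

section Conclusion

variable {X : Type*} {n p : ℕ} [TopologicalSpace X] [ChartedSpace (Cn n) X]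

theorem pullback_pair {m : ℕ} (f : Cn m → X) (η : DiffForm X n 2) (z u v : Cn m) :
    pullback (m := m) f η z ![u, v] =
      η (f z) ![dif (m := m) (n := n) f z u, dif (m := m) (n := n) f z v] := by
  rw [pullback_apply]
  congr 1
  funext i
  fin_cases i <;> rfl

theorem pullback_pair_I {m : ℕ} (f : Cn m → X) (η : DiffForm X n 2) (z v : Cn m) :
    pullback (m := m) f η z ![v, Complex.I • v] =
      η (f z) ![dif (m := m) (n := n) f z v, Complex.I • dif (m := m) (n := n) f z v] := by
  rw [pullback_pair, map_smul]

theorem IsSemiPositive.pullback_invariant {η : DiffForm X n 2} (hη : IsSemiPositive η)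
    (f : Cn p → X) (z u v : Cn p) :
    pullback (m := p) f η z ![Complex.I • u, Complex.I • v] = pullback (m := p) f η z ![u, v] := by
  rw [pullback_pair, pullback_pair, map_smul, map_smul, hη.invariant]

theorem IsSemiPositive.pullback_nonneg {η : DiffForm X n 2} (hη : IsSemiPositive η)
    (f : Cn p → X) (z u : Cn p) : 0 ≤ pullback (m := p) f η z ![u, Complex.I • u] := by
  rw [pullback_pair_I]
  exact hη.nonneg _ _

theorem pullback_dividedPower {m : ℕ} (f : Cn p → X) (η : DiffForm X n 2) (z : Cn p) :
    pullback (m := p) f (fun x => dividedPower m (η x)) z =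
      dividedPower m (pullback (m := p) f η z) := by
  ext v
  rw [pullback_apply, dividedPower_apply, dividedPower_apply]
  simp only [pullback_pair]

theorem mapVolume_eq (η : DiffForm X n 2) (f : Cn p → X) (r : ℝ) :
    mapVolume η f r = ∫ z in Metric.ball (0 : Cn p) r,
      dividedPower p (pullback (m := p) f η z) (fun k => stdFrame p k) := by
  simp only [mapVolume, ballIntegral, pullback_dividedPower]

theorem mapArea_eq (hp : 1 ≤ p) (η : DiffForm X n 2) (f : Cn p → X) {r : ℝ} (hr : 0 < r) :
    mapArea η f r = r ^ (2 * p - 1) * ∫ w : Metric.sphere (0 : Cn p) 1,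
      areaDensity (pullback (m := p) f η (r • (w : Cn p))) (w : Cn p)
        ∂(volume : Measure (Cn p)).toSphere := by
  rw [mapArea, sphereIntegral]
  congr 2
  funext w
  refine fluxDensity_hodgeStar hp _ (w : Cn p) (r := 2 * r) (by positivity) ?_
  rw [(hasStrictFDerivAt_norm_sq (r • (w : Cn p))).hasFDerivAt.fderiv, map_smul,
    ← Nat.cast_smul_eq_nsmul ℝ, smul_smul, Nat.cast_ofNat]

variable [IsManifold 𝓘(ℂ, Cn n) ω X]

theorem continuous_pullback_apply {k : ℕ} {f : Cn p → X}
    (hf : ContMDiff 𝓘(ℂ, Cn p) 𝓘(ℂ, Cn n) ω f) {η : DiffForm X n k} (hη : IsSmoothForm η)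
    (v : Fin k → Cn p) : Continuous fun z => pullback (m := p) f η z v :=
  (contDiff_pullback_apply hf hη v).continuous

theorem integrable_areaDensity (hp : 1 ≤ p) {f : Cn p → X}
    (hf : ContMDiff 𝓘(ℂ, Cn p) 𝓘(ℂ, Cn n) ω f) {η : DiffForm X n 2} (hη : IsSemiPositive η)
    (r : ℝ) :
    Integrable (fun w : Metric.sphere (0 : Cn p) 1 =>
      areaDensity (pullback (m := p) f η (r • (w : Cn p))) (w : Cn p))
      (volume : Measure (Cn p)).toSphere := by
  have hc : ∀ v, Continuous fun w : Metric.sphere (0 : Cn p) 1 =>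
      pullback (m := p) f η (r • (w : Cn p)) v := fun v =>
    (continuous_pullback_apply hf hη.smooth v).comp (continuous_subtype_val.const_smul r)
  have hB : ∀ k : Fin (2 * p), ∃ B, ∀ w : Metric.sphere (0 : Cn p) 1,
      formNorm (pullback (m := p) f η (r • (w : Cn p))) (stdFrame p k) ≤ B := fun k => by
    obtain ⟨B, hB⟩ := isCompact_univ.exists_bound_of_continuousOn
      (hc ![stdFrame p k, Complex.I • stdFrame p k]).sqrt.continuousOn
    exact ⟨B, fun w => (le_abs_self _).trans (hB w (Set.mem_univ w))⟩
  choose B hB using hB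
  refine Integrable.of_bound
    (measurable_areaDensity hc continuous_subtype_val).aestronglyMeasurable
    (2 * p * ((2 * p).factorial * 1 * (∑ k, |B k|) ^ (2 * p - 1))) (Eventually.of_forall fun w => ?_)
  have hinv := hη.pullback_invariant f (r • (w : Cn p))
  have hpos := hη.pullback_nonneg f (r • (w : Cn p))
  rw [Real.norm_of_nonneg (areaDensity_nonneg hinv hpos _)]
  have h := areaDensity_le hp hinv hpos (B := ∑ k, |B k|) (fun k => (hB k w).trans
    ((le_abs_self _).trans (Finset.single_le_sum (f := fun k => |B k|)
      (fun _ _ => abs_nonneg _) (Finset.mem_univ k)))) (w : Cn p)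
  rwa [norm_eq_of_mem_sphere w] at h

/-- The volume of large balls is positive for a map that is non-degenerate somewhere. -/
theorem mapVolume_pos {f : Cn p → X} (hf : ContMDiff 𝓘(ℂ, Cn p) 𝓘(ℂ, Cn n) ω f)
    {η : DiffForm X n 2} (hη : IsHermitianMetric η) {z₀ : Cn p}
    (hz₀ : Function.Injective (dif (m := p) (n := n) f z₀)) {r : ℝ} (hr : ‖z₀‖ < r) :
    0 < mapVolume η f r := by
  have hη' := hη.toIsSemiPositive
  have hc : Continuous fun z => dividedPower p (pullback (m := p) f η z)
      (fun k => stdFrame p k) :=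
    continuous_dividedPower_apply (continuous_pullback_apply hf hη.smooth) _
  rw [mapVolume_eq, setIntegral_pos_iff_support_of_nonneg_ae]
  · refine IsOpen.measure_pos _ (hc.isOpen_support.inter Metric.isOpen_ball)
      ⟨z₀, ?_, mem_ball_zero_iff.2 hr⟩
    refine (dividedPower_stdFrame_pos (hη'.pullback_invariant f z₀) fun u hu => ?_).ne'
    rw [pullback_pair_I]
    exact hη.pos _ _ fun h0 => hu (hz₀ (h0.trans (map_zero _).symm))
  · exact Eventually.of_forall fun z => dividedPower_stdFrame_nonneg
      (hη'.pullback_invariant f z) (hη'.pullback_nonneg f z)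
  · exact (hc.continuousOn.integrableOn_compact (isCompact_closedBall 0 r)).mono_set
      Metric.ball_subset_closedBall

end Conclusion

/-- The isoperimetric inequality for horizontal maps: the volume of a ball is bounded by the area of
the sphere. -/
theorem exists_mapVolume_le {X : Type u} {n p : ℕ} [TopologicalSpace X] [ChartedSpace (Cn n) X]
    [IsManifold 𝓘(ℂ, Cn n) ω X] [CompactSpace X] (hp : 1 ≤ p)
    (S : PartialKahlerHyperbolicStructure X n p) {f : Cn p → X}
    (hf : ContMDiff 𝓘(ℂ, Cn p) 𝓘(ℂ, Cn n) ω f)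
    (hhor : ∀ z v, dif (m := p) (n := n) f z v ∈ S.E.fiber (f z)) {η : DiffForm X n 2}
    (hη : IsHermitianMetric η) :
    ∃ K : ℝ, 0 ≤ K ∧ ∀ r, 0 < r → mapVolume η f r ≤ K * mapArea η f r := by
  obtain ⟨Y, _, _, π, hπ, k, hk, β, hβs, ⟨C, hC⟩, hdβ⟩ := S.dTildeBounded
  have := hπ.isManifold
  obtain ⟨F, hF, hFf⟩ := exists_lift hπ hf
  have hF' : ∀ z, π (F z) = f z := fun z => congrFun hFf z
  have hπd : MDifferentiable 𝓘(ℂ, Cn n) 𝓘(ℂ, Cn n) π :=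
    hπ.isLocalDiffeomorph.contMDiff.mdifferentiable (by simp)
  have hFd : MDifferentiable 𝓘(ℂ, Cn p) 𝓘(ℂ, Cn n) F := hF.mdifferentiable (by simp)
  have hη' := hη.toIsSemiPositive
  have hω := S.hermitian
  have hω' := hω.toIsSemiPositive
  set om : DiffForm X n 2 := S.omE + S.omNE with hom
  set ζ : DiffForm (Cn p) p k := pullback (m := p) F β with hζ
  obtain ⟨C₁, hC₁0, hC₁⟩ := exists_form_le hω.smooth hη
  obtain ⟨C₂, hC₂0, hC₂⟩ := exists_form_le hη.smooth hω
  have hsqrt : ∀ {a b c : ℝ}, 0 ≤ c → a ≤ c * b → √a ≤ √c * √b := fun hc h => by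
    rw [← Real.sqrt_mul hc]; exact Real.sqrt_le_sqrt h
  -- On horizontal directions, `ω` and `ω_E` agree.
  have hE : ∀ z, pullback (m := p) f om z = pullback (m := p) f S.omE z := by
    intro z
    ext v
    have h0 : S.omNE (f z) (fun i => dif (m := p) (n := n) f z (v i)) = 0 := by
      have := S.omNE_zero (f z) _ (hhor z (v 0)) _ (hhor z (v 1))
      rw [← this]
      congr 1
      funext i
      fin_cases i <;> rfl
    rw [pullback_apply, pullback_apply, hom]
    change S.omE (f z) _ + S.omNE (f z) _ = _
    rw [h0, add_zero]
  -- The volume form of `f^* ω` is the exterior derivative of the bounded form `ζ`.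
  have hext : ∀ z, extDeriv ζ z (fun l : Fin (k + 1) => stdFrame p l) =
      dividedPower p (pullback (m := p) f om z) (fun l => stdFrame p l) := by
    intro z
    rw [hE, ← pullback_dividedPower, ← hFf, pullback_comp hπd hFd, hζ, extDeriv_pullback_eq hF hβs,
      pullback_apply, pullback_apply, hdβ]
    rfl
  have hbound : ∀ z v, |ζ z v| ≤ |C| * √C₁ ^ k * ∏ i, formNorm (pullback (m := p) f η z) (v i) := by
    intro z v
    refine (hC (F z) _).trans ?_
    have h1 : ∀ i, √(pullback (m := n) π om (F z) ![dif (m := p) (n := n) F z (v i),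
        Complex.I • dif (m := p) (n := n) F z (v i)]) ≤
        √C₁ * formNorm (pullback (m := p) f η z) (v i) := by
      intro i
      refine hsqrt hC₁0 ?_
      rw [← pullback_pair_I (X := Y), ← pullback_comp hπd hFd, hFf, pullback_pair_I,
        pullback_pair_I]
      exact hC₁ _ _
    calc _ ≤ |C| * ∏ i, (√C₁ * formNorm (pullback (m := p) f η z) (v i)) :=
          mul_le_mul (le_abs_self _) (Finset.prod_le_prod (fun _ _ => Real.sqrt_nonneg _)
            fun i _ => h1 i) (Finset.prod_nonneg fun _ _ => Real.sqrt_nonneg _) (abs_nonneg _)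
      _ = _ := by rw [Finset.prod_mul_distrib]; simp [mul_assoc]
  have hcp := stdVolume_pos p
  set A : ℝ := 2 * p * (|C| * √C₁ ^ k) / stdVolume p with hA
  set D : ℝ := (2 * p).factorial * √C₂ ^ (2 * p) / stdVolume p with hD
  have hA0 : 0 ≤ A := by positivity
  have hD0 : 0 ≤ D := by positivity
  refine ⟨D * A, mul_nonneg hD0 hA0, fun r hr => ?_⟩
  have hint : ∀ θ : DiffForm X n 2, IsSmoothForm θ → IntegrableOn (fun z =>
      dividedPower p (pullback (m := p) f θ z) (fun l => stdFrame p l)) (Metric.ball 0 r) := by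
    intro θ hθ
    exact ((continuous_dividedPower_apply
      (continuous_pullback_apply hf hθ) _).continuousOn.integrableOn_compact
        (isCompact_closedBall 0 r)).mono_set Metric.ball_subset_closedBall
  have hvol : mapVolume η f r ≤ D * mapVolume om f r := by
    rw [mapVolume_eq, mapVolume_eq, ← integral_const_mul]
    refine integral_mono (hint η hη.smooth) ((hint om hω.smooth).const_mul D) fun z => ?_
    refine dividedPower_stdFrame_le (hη'.pullback_invariant f z) (hη'.pullback_nonneg f z)
      (hω'.pullback_invariant f z) (hω'.pullback_nonneg f z) fun v => hsqrt hC₂0 ?_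
    rw [pullback_pair_I, pullback_pair_I]
    exact hC₂ _ _
  have hstokes : mapVolume om f r ≤ A * mapArea η f r := by
    rw [mapVolume_eq, mapArea_eq hp η f hr]
    simp only [← hext]
    rw [integral_ball_extDeriv hk (differentiable_pullback hF hβs)
      (contDiff_pullback_apply hF hβs) hr, mul_left_comm A, ← integral_const_mul A]
    refine mul_le_mul_of_nonneg_left ?_ (by positivity)
    refine (Real.le_norm_self _).trans (norm_integral_le_of_norm_le
      ((integrable_areaDensity hp hf hη' r).const_mul A) (Eventually.of_forall fun w => ?_))
    exact abs_fluxDensity_le hk (hη'.pullback_invariant f _) (hη'.pullback_nonneg f _)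
      (hbound _) _
  calc mapVolume η f r ≤ D * mapVolume om f r := hvol
    _ ≤ D * (A * mapArea η f r) := mul_le_mul_of_nonneg_left hstokes hD0
    _ = _ := by ring

theorem stronglyPartiallyHyperbolic {X : Type u} {n p : ℕ} [TopologicalSpace X]
    [ChartedSpace (Cn n) X] [IsManifold 𝓘(ℂ, Cn n) ω X] [CompactSpace X] (hp : 1 ≤ p)
    (S : PartialKahlerHyperbolicStructure X n p) : StronglyPartiallyHyperbolic p S.E := by
  rintro ⟨f, hf⟩
  obtain ⟨z₀, hz₀⟩ := hf.nondegenerate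
  obtain ⟨η, hη, hgrowth⟩ := hf.growth
  obtain ⟨K, hK0, hK⟩ := exists_mapVolume_le hp S hf.holomorphic hf.horizontal hη
  have hvol : ∀ r, ‖z₀‖ < r → 0 < mapVolume η f r := fun r hr =>
    mapVolume_pos hf.holomorphic hη hz₀ hr
  have hr₀ : ‖z₀‖ < ‖z₀‖ + 1 := by linarith
  have hKpos : 0 < K := by
    refine hK0.lt_of_ne fun h0 => ?_
    have h1 := hK (‖z₀‖ + 1) (by positivity)
    rw [← h0, zero_mul] at h1
    exact absurd (hvol _ hr₀) (not_lt.2 h1)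
  have hlower : ∀ᶠ r in atTop, ((K⁻¹ : ℝ) : EReal) ≤
      ((mapArea η f r / mapVolume η f r : ℝ) : EReal) := by
    filter_upwards [eventually_gt_atTop ‖z₀‖] with r hr
    have h1 := hK r ((norm_nonneg _).trans_lt hr)
    rw [EReal.coe_le_coe_iff, le_div_iff₀ (hvol r hr), inv_mul_le_iff₀ hKpos]
    exact h1
  have h2 := le_liminf_of_le (by isBoundedDefault) hlower
  rw [GrowthCondition] at hgrowth
  rw [hgrowth] at h2
  have h3 : K⁻¹ ≤ 0 := by exact_mod_cast h2
  exact absurd (inv_pos.2 hKpos) (not_lt.2 h3)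

end PartialHyp

theorem theorem4p6 {X : Type u} (n p : ℕ) [TopologicalSpace X] [ChartedSpace (Cn n) X]
    [IsManifold 𝓘(ℂ, Cn n) ω X] [CompactSpace X] [T2Space X] [ConnectedSpace X]
    (hp : 1 ≤ p) (hpn : p < n) (S : PartialKahlerHyperbolicStructure X n p) :
    StronglyPartiallyHyperbolic p S.E ∧
      ¬ ∃ (f : Cn p → X) (η : DiffForm X n 2) (T : smoothForms X n (2 * p) →ₗ[ℝ] ℝ),
        IsExcludedMap S.E f ∧ IsHermitianMetric η ∧ IsAhlforsCurrent η f T := by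
  have h := stronglyPartiallyHyperbolic hp S
  exact ⟨h, fun ⟨f, _, _, hf, _, _⟩ => h ⟨f, hf⟩⟩
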